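/- Let $m\ge 1$ be an integer and $a_1,\dots,a_m>0$ constants with $\sum_{i=1}^m a_i=1$. For each $n$ let $P_n$ and $K_{1,n},\dots,K_{m,n}$ be integers with $1\le K_{i,n}\le P_n$. The general random intersection graph $\mathbb{G}(n,\overrightarrow{a},\overrightarrow{K_n},P_n)$ has $n$ vertices; each vertex independently joins exactly one of $m$ groups, group $i$ with probability $a_i$; a vertex in group $i$ then independently chooses a uniformly random subset of size $K_{i,n}$ of a pool of $P_n$ objects; two distinct vertices are adjacent if and only if they share at least one object. Let $b_{1,n}$ be the conditional probability that two given distinct vertices $x,y$ are adjacent, given that $x$ belongs to group $1$, that is, $$b_{1,n}=\sum_{j=1}^{m} a_j\left[1-\frac{\binom{P_n-K_{1,n}}{K_{j,n}}}{\binom{P_n}{K_{j,n}}}\right].$$ **Theorem.** Suppose that, as $n\to\infty$, $P_n=\Omega(n)$ and $\omega(1)=K_{1,n}\le K_{2,n}\le\dots\le K_{m,n}=o(\sqrt{P_n})$, and that $$b_{1,n}=\frac{\ln n+\beta_n}{n}$$ for a real sequence $\beta_n$ with $|\beta_n|=o(\ln n)$. Then $$\lim_{n\to\infty}\mathbb{P}\big[\mathbb{G}(n,\overrightarrow{a},\overrightarrow{K_n},P_n)\text{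 is connected}\big]=\begin{cases}0, & \text{if }\lim_{n\to\infty}\beta_n=-\infty,\\ 1, & \text{if }\lim_{n\to\infty}\beta_n=+\infty.\end{cases}$$ -/

import Mathlib

open MeasureTheory ProbabilityTheory Filter Topology Asymptotics

/-- The random choice attached to a vertex: the group it joins, and its set of objects. There are
`m + 1` groups, indexed by `Fin (m + 1)`, and the pool of objects is `Fin P`. -/
abbrev VertexChoice (m P : ℕ) : Type := Fin (m + 1) × Finset (Fin P)

/-- The law of the choice of one vertex: it joins group `i` with probability `a i` and, given that,
its object set is uniformly distributed among all subsets of the pool of size `K i`. -/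
noncomputable def vertexLaw {m : ℕ} (a : Fin (m + 1) → ℝ) (K : Fin (m + 1) → ℕ) (P : ℕ) :
    Measure (VertexChoice m P) :=
  ∑ i, ENNReal.ofReal (a i) •
    (Measure.dirac i).prod (uniformOn {S : Finset (Fin P) | S.card = K i})

/-- The joint law of the choices of the `n` vertices, which are independent. -/
noncomputable def choicesLaw (n : ℕ) {m : ℕ} (a : Fin (m + 1) → ℝ) (K : Fin (m + 1) → ℕ) (P : ℕ) :
    Measure (Fin n → VertexChoice m P) :=
  Measure.pi fun _ => vertexLaw a K P

/-- The intersection graph on the `n` vertices: two different vertices are adjacent if and only if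
they share at least one object. -/
def intersectionGraph {n m P : ℕ} (ω : Fin n → VertexChoice m P) : SimpleGraph (Fin n) where
  Adj x y := x ≠ y ∧ ((ω x).2 ∩ (ω y).2).Nonempty
  symm := ⟨fun _ _ h => ⟨h.1.symm, by rw [Finset.inter_comm]; exact h.2⟩⟩
  loopless := ⟨fun _ h => h.1 rfl⟩

/-- The probability that the random intersection graph with parameters `n`, `a`, `K`, `P` is
connected. -/
noncomputable def probConnected (n : ℕ) {m : ℕ} (a : Fin (m + 1) → ℝ) (K : Fin (m + 1) → ℕ)
    (P : ℕ) : ℝ :=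
  (choicesLaw n a K P).real {ω | (intersectionGraph ω).Connected}

/-- The conditional probability that the vertices `x` and `y` are adjacent in the random
intersection graph, given that `x` belongs to group `i`. -/
noncomputable def edgeProb {n m : ℕ} (a : Fin (m + 1) → ℝ) (K : Fin (m + 1) → ℕ) (P : ℕ)
    (x y : Fin n) (i : Fin (m + 1)) : ℝ :=
  (cond (choicesLaw n a K P) {ω | (ω x).1 = i}).real {ω | (intersectionGraph ω).Adj x y}

lemma isProbabilityMeasure_uniformOn_card {P k : ℕ} (h : k ≤ P) :
    IsProbabilityMeasure (uniformOn {S : Finset (Fin P) | S.card = k}) := by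
  refine isProbabilityMeasure_uniformOn (Set.toFinite _) ?_
  obtain ⟨S, -, hS⟩ := Finset.exists_subset_card_eq (s := (Finset.univ : Finset (Fin P)))
    (n := k) (by simpa using h)
  exact ⟨S, hS⟩

/-- The law of one vertex is a probability measure. -/
lemma isProbabilityMeasure_vertexLaw {m : ℕ} {a : Fin (m + 1) → ℝ} (ha : ∀ i, 0 < a i)
    (hs : ∑ i, a i = 1) {K : Fin (m + 1) → ℕ} {P : ℕ} (hK : ∀ i, K i ≤ P) :
    IsProbabilityMeasure (vertexLaw a K P) := by
  constructor
  have := fun i => isProbabilityMeasure_uniformOn_card (hK i)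
  simp only [vertexLaw, Measure.finsetSum_apply, Measure.smul_apply, measure_univ, smul_eq_mul,
    mul_one]
  rw [← ENNReal.ofReal_sum_of_nonneg fun i _ => (ha i).le, hs, ENNReal.ofReal_one]

lemma vertexLaw_apply {m : ℕ} (a : Fin (m + 1) → ℝ) (K : Fin (m + 1) → ℕ) (P : ℕ)
    (s : Set (VertexChoice m P)) :
    vertexLaw a K P s = ∑ i, ENNReal.ofReal (a i) *
      uniformOn {S : Finset (Fin P) | S.card = K i} {S | (i, S) ∈ s} := by
  simp only [vertexLaw, Measure.finsetSum_apply, Measure.smul_apply, smul_eq_mul]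
  refine Finset.sum_congr rfl fun i _ => ?_
  rw [Measure.dirac_prod, Measure.map_apply (by fun_prop) (Set.toFinite s).measurableSet]
  rfl

lemma uniformOn_card_inter {P k : ℕ} (hk : k ≤ P) (T : Finset (Fin P)) :
    uniformOn {S : Finset (Fin P) | S.card = k} {S | (T ∩ S).Nonempty} =
      ENNReal.ofReal (1 - ((P - T.card).choose k : ℝ) / (P.choose k : ℝ)) := by
  have := isProbabilityMeasure_uniformOn_card hk
  have h1 : {S : Finset (Fin P) | S.card = k} =
      ((Finset.powersetCard k Finset.univ : Finset (Finset (Fin P))) : Set _) := by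
    ext; simp
  have h2 : {S : Finset (Fin P) | (T ∩ S).Nonempty} =
      (((Finset.powerset Tᶜ : Finset (Finset (Fin P)))) : Set (Finset (Fin P)))ᶜ := by
    ext S
    simp [Set.subset_compl_iff_disjoint_left, Finset.disjoint_iff_inter_eq_empty,
      Finset.nonempty_iff_ne_empty]
  have h3 : Finset.powersetCard k Finset.univ ∩ Finset.powerset Tᶜ = Finset.powersetCard k Tᶜ := by
    ext; simp [Finset.mem_powersetCard, and_comm]
  have hpos : (0 : ℝ) < P.choose k := by exact_mod_cast Nat.choose_pos hk
  rw [h2, prob_compl_eq_one_sub (Set.toFinite _).measurableSet, h1, uniformOn_apply_finset, h3,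
    Finset.card_powersetCard, Finset.card_powersetCard, Finset.card_compl, Finset.card_univ,
    Fintype.card_fin, ENNReal.ofReal_sub _ (by positivity), ENNReal.ofReal_one,
    ENNReal.ofReal_div_of_pos hpos, ENNReal.ofReal_natCast, ENNReal.ofReal_natCast]

/-- The edge probability does not depend on the two vertices, and is given by the usual formula. -/
theorem edgeProb_eq {n m : ℕ} {a : Fin (m + 1) → ℝ} (ha : ∀ i, 0 < a i)
    (hs : ∑ i, a i = 1) {K : Fin (m + 1) → ℕ} {P : ℕ} (hK : ∀ i, K i ≤ P)
    {x y : Fin n} (hxy : x ≠ y) (i : Fin (m + 1)) :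
    edgeProb a K P x y i =
      ∑ j, a j * (1 - ((P - K i).choose (K j) : ℝ) / (P.choose (K j) : ℝ)) := by
  have hprob := isProbabilityMeasure_vertexLaw ha hs hK
  set ν := vertexLaw a K P with hν
  set b := ∑ j, a j * (1 - ((P - K i).choose (K j) : ℝ) / (P.choose (K j) : ℝ)) with hb
  have hnn : ∀ j, (0:ℝ) ≤ 1 - ((P - K i).choose (K j) : ℝ) / (P.choose (K j) : ℝ) := fun j => by
    rw [sub_nonneg]
    refine div_le_one_of_le₀ ?_ (by positivity)
    exact_mod_cast Nat.choose_le_choose _ (Nat.sub_le _ _)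
  have hb0 : 0 ≤ b := Finset.sum_nonneg fun j _ => mul_nonneg (ha j).le (hnn j)
  have hone : ν {c | c.1 = i} = ENNReal.ofReal (a i) := by
    have := fun i => isProbabilityMeasure_uniformOn_card (hK i)
    rw [hν, vertexLaw_apply, Finset.sum_eq_single i]
    · simp
    · intro j _ hj
      simp [hj]
    · simp
  have hmap : (choicesLaw n a K P).map (fun ω => (ω x, ω y)) = ν.prod ν := by
    have h1 := (iIndepFun_pi (μ := fun _ : Fin n => ν) (X := fun _ c => c)
      fun _ => aemeasurable_id).indepFun hxy
    rw [indepFun_iff_map_prod_eq_prod_map_map (measurable_pi_apply x).aemeasurable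
      (measurable_pi_apply y).aemeasurable] at h1
    rw [(measurePreserving_eval (fun _ : Fin n => ν) x).map_eq,
      (measurePreserving_eval (fun _ : Fin n => ν) y).map_eq] at h1
    exact h1
  have hmeas : Measurable fun ω : Fin n → VertexChoice m P => (ω x, ω y) := by fun_prop
  have hA : choicesLaw n a K P {ω | (ω x).1 = i} = ENNReal.ofReal (a i) := by
    have : {ω : Fin n → VertexChoice m P | (ω x).1 = i} =
      (fun ω => (ω x, ω y)) ⁻¹' ({c | c.1 = i} ×ˢ Set.univ) := by ext; simp
    rw [this, ← Measure.map_apply hmeas (Set.toFinite _).measurableSet, hmap, Measure.prod_prod,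
      hone, measure_univ, mul_one]
  have hinner : ∀ T : Finset (Fin P), T.card = K i →
      ν {d | (T ∩ d.2).Nonempty} = ENNReal.ofReal b := by
    intro T hT
    rw [hν, vertexLaw_apply, hb, ENNReal.ofReal_sum_of_nonneg
      fun j _ => mul_nonneg (ha j).le (hnn j)]
    refine Finset.sum_congr rfl fun j _ => ?_
    rw [ENNReal.ofReal_mul (ha j).le, ← hT, ← uniformOn_card_inter (hK j) T]
    rfl
  have hAB : choicesLaw n a K P ({ω | (ω x).1 = i} ∩ {ω | (intersectionGraph ω).Adj x y}) =
      ENNReal.ofReal (a i) * ENNReal.ofReal b := by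
    have : ({ω | (ω x).1 = i} ∩ {ω | (intersectionGraph ω).Adj x y} :
        Set (Fin n → VertexChoice m P)) = (fun ω => (ω x, ω y)) ⁻¹'
          {p | p.1.1 = i ∧ (p.1.2 ∩ p.2.2).Nonempty} := by
      ext; simp [intersectionGraph, hxy]
    rw [this, ← Measure.map_apply hmeas (Set.toFinite _).measurableSet, hmap,
      Measure.prod_apply (Set.toFinite _).measurableSet]
    have hsupp : ∀ᵐ c ∂ν, c.2.card = K c.1 := by
      rw [ae_iff, hν, vertexLaw_apply]
      refine Finset.sum_eq_zero fun j _ => ?_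
      have := isProbabilityMeasure_uniformOn_card (hK j)
      have h0 : uniformOn {S : Finset (Fin P) | S.card = K j} {S | ¬ S.card = K j} = 0 := by
        rw [uniformOn, cond_apply (Set.toFinite _).measurableSet]
        have : ({S : Finset (Fin P) | S.card = K j} ∩ {S | ¬ S.card = K j}) = ∅ := by
          ext; simp
        simp [this]
      simpa using Or.inr h0
    rw [lintegral_congr_ae (g := Set.indicator {c | c.1 = i} fun _ => ENNReal.ofReal b)]
    · rw [lintegral_indicator_const (Set.toFinite _).measurableSet, hone, mul_comm]
    · filter_upwards [hsupp] with c hc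
      by_cases h : c.1 = i
      · rw [h] at hc
        simp [h, hinner c.2 hc]
      · simp [h]
  rw [edgeProb, measureReal_def, cond_apply (Set.toFinite _).measurableSet, hA, hAB, ← mul_assoc,
    ENNReal.inv_mul_cancel (by simpa using ha i) ENNReal.ofReal_ne_top, one_mul,
    ENNReal.toReal_ofReal hb0]

/-!
Write `q u` for the probability `avoidProb` that a vertex uses none of `u` given objects, `K` for
the smallest size `K n 0`, and `b = 1 - q K = (log n + β) / n`. The probability `b` is comparable
with `θ = overlapMean`, the mean number of objects that a vertex of group `0` shares with another
vertex: the union bound gives `b ≤ θ`, and `θ ≤ 2 b` because `K n (Fin.last m) ^ 2 ≤ P n`.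

If `β → -∞`, the number of isolated vertices of group `0` has mean `n a₀ (1 - b) ^ (n - 1)`, of
order `exp (-β)`, and two vertices are isolated almost independently since `q (2 K)` differs from
`(1 - b) ^ 2` only by `O(b ^ 2)`. Chebyshev's inequality (`probConnected_le_of_isolated`) shows that
such a vertex exists with probability tending to one.

If `β → ∞`, the expected number of cuts, that is, of sets of at most `n / 2` vertices without
neighbours outside, has to be shown to be small. The key estimate is `choicesLaw_separated_le`: the
probability that the `r` vertices of `A` share no object with the vertices of `B` is at most the
mean of `q U ^ B.card`, where `U` is the number of distinct values among `r K` independent uniform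
objects. It replaces every vertex of `A` by one of the smallest size, and it reduces the analysis
to the collisions of a random function.

* For `r ≤ n ^ (1 / 3)` the number of collisions has small exponential moments
  (`imageMean_pow_le`), so there are at most `O(exp (-r β))` cuts of size `r` on average.
* For larger `r`, up to a small multiple `c n`, the loss of a constant factor in the exponent is
  affordable, and the lower tail of `U` is controlled by `imageMean_le_tail`. That tail beats the
  number of sets of size `r` because `K → ∞` and `n = O(P)`.
* For `r ≥ c n` the mean of `q U ^ (n - r)` is too large, since vertices of small groups may avoid
  many objects. But one side of the cut contains half of the last group, and each of these vertices
  is adjacent to a given set of `c n` vertices with probability tending to one; this beats the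
  number `4 ^ n` of pairs of sets of vertices (`choicesLaw_separated_last_le`).
-/

/-! ### Sums over finite products -/

/-- The mean of a product of functions of independent coordinates. -/
lemma sum_prod_mul_prod {ι α : Type*} [Fintype ι] [DecidableEq ι] [Fintype α]
    (w : α → ℝ) (h : ι → α → ℝ) :
    ∑ t : ι → α, (∏ i, w (t i)) * ∏ i, h i (t i) = ∏ i, ∑ c, w c * h i c := by
  rw [Finset.prod_univ_sum, Fintype.piFinset_univ]
  exact Finset.sum_congr rfl fun t _ => Finset.prod_mul_distrib.symm

/-- Fubini for a product weight, with the coordinates split into those in `A` and the others. -/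
lemma sum_prod_mul_split {ι α : Type*} [Fintype ι] [Fintype α] [DecidableEq ι] (A : Finset ι)
    (w : α → ℝ) (Φ : ({v // v ∈ A} → α) → ({v // v ∉ A} → α) → ℝ) :
    ∑ t : ι → α, (∏ i, w (t i)) * Φ (fun v => t v) (fun v => t v) =
      ∑ s : {v // v ∈ A} → α, (∏ i, w (s i)) *
        ∑ t : {v // v ∉ A} → α, (∏ i, w (t i)) * Φ s t := by
  rw [← (Equiv.piEquivPiSubtypeProd (fun v => v ∈ A) (fun _ => α)).symm.sum_comp,
    Fintype.sum_prod_type]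
  refine Finset.sum_congr rfl fun s _ => ?_
  rw [Finset.mul_sum]
  refine Finset.sum_congr rfl fun t _ => ?_
  rw [← mul_assoc, ← Fintype.prod_subtype_mul_prod_subtype (fun v => v ∈ A)]
  have h1 : (fun v : {v // v ∈ A} =>
      (Equiv.piEquivPiSubtypeProd (fun v => v ∈ A) (fun _ => α)).symm (s, t) v) = s := by
    ext i; simp [Equiv.piEquivPiSubtypeProd, i.2]
  have h2 : (fun v : {v // v ∉ A} =>
      (Equiv.piEquivPiSubtypeProd (fun v => v ∈ A) (fun _ => α)).symm (s, t) v) = t := by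
    ext i; simp [Equiv.piEquivPiSubtypeProd, i.2]
  rw [h1, h2]
  congr 2
  · exact Finset.prod_congr (by ext; simp) fun i _ => congrArg w (congrFun h1 i)
  · exact Finset.prod_congr rfl fun i _ => congrArg w (congrFun h2 i)

/-! ### The law of the choices as a weighted sum -/

/-- The probability that a vertex makes the choice `c`. -/
noncomputable def choiceWeight {m : ℕ} (a : Fin (m + 1) → ℝ) (K : Fin (m + 1) → ℕ) (P : ℕ)
    (c : VertexChoice m P) : ℝ :=
  if c.2.card = K c.1 then a c.1 * ((P.choose (K c.1) : ℝ))⁻¹ else 0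

lemma choiceWeight_nonneg {m : ℕ} {a : Fin (m + 1) → ℝ} (ha : ∀ i, 0 < a i)
    (K : Fin (m + 1) → ℕ) (P : ℕ) (c : VertexChoice m P) : 0 ≤ choiceWeight a K P c := by
  have := (ha c.1).le
  unfold choiceWeight
  split_ifs <;> positivity

lemma vertexLaw_real_singleton {m : ℕ} {a : Fin (m + 1) → ℝ} (ha : ∀ i, 0 < a i)
    (K : Fin (m + 1) → ℕ) (P : ℕ) (c : VertexChoice m P) :
    (vertexLaw a K P).real {c} = choiceWeight a K P c := by
  obtain ⟨i, S⟩ := c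
  have h1 : {S : Finset (Fin P) | S.card = K i} =
      ((Finset.powersetCard (K i) Finset.univ : Finset (Finset (Fin P))) : Set _) := by
    ext; simp
  rw [measureReal_def, vertexLaw_apply, Finset.sum_eq_single i]
  · have h2 : {T : Finset (Fin P) | (i, T) ∈ ({(i, S)} : Set (VertexChoice m P))} =
        (({S} : Finset (Finset (Fin P))) : Set _) := by ext; simp
    rw [h2, h1, uniformOn_apply_finset, ENNReal.toReal_mul, ENNReal.toReal_ofReal (ha i).le,
      Finset.card_powersetCard, Finset.card_univ, Fintype.card_fin, choiceWeight]
    by_cases h : S.card = K i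
    · rw [Finset.inter_singleton_of_mem (by simp [h])]
      simp [h]
    · rw [Finset.inter_singleton_of_notMem (by simp [h])]
      simp [h]
  · intro j _ hj
    have : {T : Finset (Fin P) | (j, T) ∈ ({(i, S)} : Set (VertexChoice m P))} = ∅ := by
      ext; simp [hj]
    rw [this, measure_empty, mul_zero]
  · simp

lemma choicesLaw_real_eq {n m : ℕ} {a : Fin (m + 1) → ℝ} (ha : ∀ i, 0 < a i)
    (hs : ∑ i, a i = 1) {K : Fin (m + 1) → ℕ} {P : ℕ} (hK : ∀ i, K i ≤ P)
    (E : Set (Fin n → VertexChoice m P)) :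
    (choicesLaw n a K P).real E =
      ∑ ω, (∏ v, choiceWeight a K P (ω v)) * E.indicator (fun _ => 1) ω := by
  classical
  have := isProbabilityMeasure_vertexLaw ha hs hK
  have : IsProbabilityMeasure (choicesLaw n a K P) := by unfold choicesLaw; infer_instance
  have hE : E = ((Finset.univ.filter (· ∈ E) : Finset _) : Set (Fin n → VertexChoice m P)) := by
    ext; simp
  conv_lhs => rw [hE]
  rw [← sum_measureReal_singleton, Finset.sum_filter]
  refine Finset.sum_congr rfl fun ω _ => ?_
  by_cases h : ω ∈ E
  · simp only [h, if_true, Set.indicator_of_mem, mul_one]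
    rw [measureReal_def, choicesLaw, Measure.pi_singleton, ENNReal.toReal_prod]
    exact Finset.prod_congr rfl fun v _ => vertexLaw_real_singleton ha K P (ω v)
  · simp [h]

/-- The probability that the object set of a vertex avoids a given set of `u` objects. -/
noncomputable def avoidProb {m : ℕ} (a : Fin (m + 1) → ℝ) (K : Fin (m + 1) → ℕ) (P u : ℕ) : ℝ :=
  ∑ j, a j * (((P - u).choose (K j) : ℝ) / (P.choose (K j) : ℝ))

open scoped Classical in
lemma sum_choiceWeight_avoid {m : ℕ} (a : Fin (m + 1) → ℝ) (K : Fin (m + 1) → ℕ) (P : ℕ)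
    (D : Finset (Fin (m + 1))) (V : Finset (Fin P)) :
    ∑ c, choiceWeight a K P c * (if c.1 ∈ D ∧ Disjoint c.2 V then 1 else 0) =
      ∑ j ∈ D, a j * (((P - V.card).choose (K j) : ℝ) / (P.choose (K j) : ℝ)) := by
  rw [Fintype.sum_prod_type, ← Finset.sum_subset (Finset.subset_univ D)]
  · refine Finset.sum_congr rfl fun j hj => ?_
    have h3 : Finset.univ.filter (fun S : Finset (Fin P) => S.card = K j ∧ Disjoint S V) =
        Finset.powersetCard (K j) Vᶜ := by
      ext S
      simp [Finset.mem_powersetCard, and_comm, Finset.subset_compl_iff_disjoint_right]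
    have h4 : ((P - V.card).choose (K j) : ℝ) =
        ∑ S : Finset (Fin P), if S.card = K j ∧ Disjoint S V then (1 : ℝ) else 0 := by
      rw [Finset.sum_boole, h3, Finset.card_powersetCard, Finset.card_compl, Fintype.card_fin]
    rw [h4, div_eq_mul_inv, Finset.sum_mul, Finset.mul_sum]
    refine Finset.sum_congr rfl fun S _ => ?_
    by_cases h : S.card = K j <;> by_cases h' : Disjoint S V <;> simp [choiceWeight, h, h', hj]
  · intro j _ hj
    simp [hj]

lemma sum_choiceWeight {m : ℕ} {a : Fin (m + 1) → ℝ} (hs : ∑ i, a i = 1)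
    {K : Fin (m + 1) → ℕ} {P : ℕ} (hK : ∀ i, K i ≤ P) : ∑ c, choiceWeight a K P c = 1 := by
  classical
  have h := sum_choiceWeight_avoid a K P Finset.univ ∅
  simp only [Finset.mem_univ, Finset.disjoint_empty_right, and_self, if_true, mul_one,
    Finset.card_empty, Nat.sub_zero] at h
  rw [h, ← hs]
  refine Finset.sum_congr rfl fun j _ => ?_
  have : (P.choose (K j) : ℝ) ≠ 0 := by exact_mod_cast (Nat.choose_pos (hK j)).ne'
  rw [div_self this, mul_one]

/-! ### Binomial estimates -/

lemma choose_succ_ratio {P k u : ℕ} (hk : k + 1 ≤ P) :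
    ((P - u).choose (k + 1) : ℝ) / P.choose (k + 1) =
      ((P - u).choose k : ℝ) / P.choose k * (((P - u - k : ℕ) : ℝ) / ((P - k : ℕ) : ℝ)) := by
  have h1 : ((P - u).choose (k + 1) : ℝ) * (k + 1) = (P - u).choose k * ((P - u - k : ℕ) : ℝ) := by
    exact_mod_cast Nat.choose_succ_right_eq (P - u) k
  have h2 : (P.choose (k + 1) : ℝ) * (k + 1) = P.choose k * ((P - k : ℕ) : ℝ) := by
    exact_mod_cast Nat.choose_succ_right_eq P k
  have h3 : (0 : ℝ) < P.choose (k + 1) := by exact_mod_cast Nat.choose_pos hk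
  have h4 : (0 : ℝ) < P.choose k := by exact_mod_cast Nat.choose_pos (by omega)
  have h5 : (0 : ℝ) < ((P - k : ℕ) : ℝ) := by exact_mod_cast (by omega : 0 < P - k)
  have h6 : (0 : ℝ) < (k : ℝ) + 1 := by positivity
  rw [← mul_div_mul_right _ _ h6.ne', h1, h2, mul_div_mul_comm]

lemma choose_ratio_le_pow {P u : ℕ} (hu : u ≤ P) :
    ∀ {k : ℕ}, k ≤ P → ((P - u).choose k : ℝ) / P.choose k ≤ (1 - (u : ℝ) / P) ^ k
  | 0, _ => by simp
  | k + 1, hk => by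
    have hP : (0 : ℝ) < P := by exact_mod_cast (by omega : 0 < P)
    have h5 : (0 : ℝ) < ((P - k : ℕ) : ℝ) := by exact_mod_cast (by omega : 0 < P - k)
    rw [choose_succ_ratio hk, pow_succ]
    have hu1 : (0 : ℝ) ≤ 1 - (u : ℝ) / P := by
      rw [sub_nonneg, div_le_one hP]; exact_mod_cast hu
    refine mul_le_mul (choose_ratio_le_pow hu (by omega)) ?_ (by positivity) (by positivity)
    rw [one_sub_div hP.ne', div_le_div_iff₀ h5 hP, Nat.cast_sub (by omega : k ≤ P)]
    have hk0 : (k : ℝ) ≤ P := by exact_mod_cast (by omega : k ≤ P)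
    have hu0 : (u : ℝ) ≤ P := by exact_mod_cast hu
    by_cases h : u + k ≤ P
    · rw [Nat.sub_sub, Nat.cast_sub h]
      push_cast
      nlinarith [mul_nonneg (Nat.cast_nonneg (α := ℝ) u) (Nat.cast_nonneg (α := ℝ) k)]
    · rw [show P - u - k = 0 by omega, Nat.cast_zero, zero_mul]
      exact mul_nonneg (by linarith) (by linarith)

/-- Union bound over the `k` objects of a random `k`-set, for the probability that it meets a
given `u`-set. -/
lemma one_sub_le_choose_ratio {P u : ℕ} (hu : 1 ≤ u) :
    ∀ {k : ℕ}, k ≤ P → 1 - (u : ℝ) * k / P ≤ ((P - u).choose k : ℝ) / P.choose k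
  | 0, _ => by simp
  | k + 1, hk => by
    have hP : (0 : ℝ) < P := by exact_mod_cast (by omega : 0 < P)
    have h5 : (0 : ℝ) < ((P - k : ℕ) : ℝ) := by exact_mod_cast (by omega : 0 < P - k)
    have hu1 : (1 : ℝ) ≤ u := by exact_mod_cast hu
    rw [choose_succ_ratio hk]
    by_cases h : u + k ≤ P
    · refine le_trans ?_ (mul_le_mul_of_nonneg_right (one_sub_le_choose_ratio hu (by omega))
        (by positivity))
      rw [Nat.sub_sub, Nat.cast_sub h] at *
      rw [Nat.cast_sub (by omega : k ≤ P)] at *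
      push_cast
      rw [one_sub_div hP.ne', one_sub_div hP.ne', div_mul_div_comm,
        div_le_div_iff₀ hP (by positivity)]
      have : 0 ≤ (P : ℝ) * (u * ((u - 1) * k)) := by
        have : (0 : ℝ) ≤ u - 1 := by linarith
        positivity
      nlinarith
    · have h6 : (P : ℝ) ≤ u * (k + 1) := by
        have : P ≤ u * (k + 1) := by nlinarith
        exact_mod_cast this
      refine le_trans ?_ (by positivity)
      rw [sub_nonpos, one_le_div hP]
      exact_mod_cast h6

lemma choose_ratio_le_exp {P u k : ℕ} (hu : u ≤ P) (hk : k ≤ P) :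
    ((P - u).choose k : ℝ) / P.choose k ≤ Real.exp (-((u : ℝ) * k / P)) := by
  refine (choose_ratio_le_pow hu hk).trans ?_
  have h1 : (0 : ℝ) ≤ 1 - (u : ℝ) / P := by
    rw [sub_nonneg]; exact div_le_one_of_le₀ (by exact_mod_cast hu) (by positivity)
  calc (1 - (u : ℝ) / P) ^ k ≤ (Real.exp (-((u : ℝ) / P))) ^ k :=
        pow_le_pow_left₀ h1 (Real.one_sub_le_exp_neg _) _
    _ = _ := by rw [← Real.exp_nat_mul]; congr 1; ring

lemma exp_neg_le_quadratic {x : ℝ} (hx : 0 ≤ x) : Real.exp (-x) ≤ 1 - x + x ^ 2 / 2 := by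
  have h := Real.quadratic_le_exp_of_nonneg hx
  have h0 : (0 : ℝ) < 1 - x + x ^ 2 / 2 := by nlinarith [sq_nonneg (x - 1)]
  rw [Real.exp_neg, inv_le_comm₀ (Real.exp_pos _) h0]
  refine le_trans ?_ h
  rw [inv_le_iff_one_le_mul₀ h0]
  nlinarith [sq_nonneg (x ^ 2)]

lemma choose_le_exp {P u : ℕ} (hu : 0 < u) :
    (P.choose u : ℝ) ≤ Real.exp u * ((P : ℝ) / u) ^ u := by
  rcases Nat.eq_zero_or_pos P with rfl | hP
  · rw [Nat.choose_eq_zero_of_lt hu, Nat.cast_zero]; positivity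
  have hP' : (0 : ℝ) < P := by exact_mod_cast hP
  have hu' : (0 : ℝ) < u := by exact_mod_cast hu
  by_cases huP : u ≤ P
  swap
  · rw [Nat.choose_eq_zero_of_lt (by omega), Nat.cast_zero]; positivity
  set x : ℝ := u / P with hx
  have hx0 : 0 < x := by positivity
  have h1 : (P.choose u : ℝ) * x ^ u ≤ (1 + x) ^ P := by
    rw [add_comm, add_pow]
    refine le_trans (le_of_eq ?_) (Finset.single_le_sum
      (f := fun i => x ^ i * 1 ^ (P - i) * (P.choose i : ℝ)) (fun i _ => by positivity)
      (Finset.mem_range.2 (by omega : u < P + 1)))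
    simp [mul_comm]
  have h2 : (1 + x) ^ P ≤ Real.exp u := by
    calc (1 + x) ^ P ≤ (Real.exp x) ^ P :=
          pow_le_pow_left₀ (by positivity) (by linarith [Real.add_one_le_exp x]) _
      _ = Real.exp u := by rw [← Real.exp_nat_mul, hx]; congr 1; field_simp
  have h3 : ((P : ℝ) / u) ^ u = (x ^ u)⁻¹ := by rw [← inv_pow, hx, inv_div]
  rw [h3, ← div_eq_mul_inv, le_div_iff₀ (by positivity)]
  exact h1.trans h2

/-- For `r` small compared with `n`, `n.choose r` grows at an arbitrarily small exponential rate. -/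
lemma choose_le_exp_mul {n r : ℕ} {x c : ℝ} (hx0 : 0 < x) (hx1 : x ≤ 1)
    (hr : (r : ℝ) ≤ c * n) :
    (n.choose r : ℝ) ≤ Real.exp (n * (x + c * Real.log x⁻¹)) := by
  by_cases hrn : r ≤ n
  swap
  · rw [Nat.choose_eq_zero_of_lt (by omega), Nat.cast_zero]; positivity
  have h1 : (n.choose r : ℝ) * x ^ r ≤ (1 + x) ^ n := by
    rw [add_comm, add_pow]
    refine le_trans (le_of_eq ?_) (Finset.single_le_sum
      (f := fun i => x ^ i * 1 ^ (n - i) * (n.choose i : ℝ)) (fun i _ => by positivity)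
      (Finset.mem_range.2 (by omega : r < n + 1)))
    simp [mul_comm]
  have h2 : (1 + x) ^ n ≤ Real.exp (n * x) := by
    calc (1 + x) ^ n ≤ (Real.exp x) ^ n :=
          pow_le_pow_left₀ (by positivity) (by linarith [Real.add_one_le_exp x]) _
      _ = _ := by rw [← Real.exp_nat_mul]
  have h3 : x ^ r = Real.exp (-(r * Real.log x⁻¹)) := by
    rw [Real.log_inv, mul_neg, neg_neg, Real.exp_nat_mul, Real.exp_log hx0]
  have hl : 0 ≤ Real.log x⁻¹ := Real.log_nonneg ((one_le_inv₀ hx0).2 hx1)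
  have h4 : (n.choose r : ℝ) ≤ Real.exp (n * x) * Real.exp (r * Real.log x⁻¹) := by
    have := h1.trans h2
    rw [h3] at this
    calc (n.choose r : ℝ) = n.choose r * Real.exp (-(r * Real.log x⁻¹)) *
          Real.exp (r * Real.log x⁻¹) := by
            rw [mul_assoc, ← Real.exp_add, neg_add_cancel, Real.exp_zero, mul_one]
      _ ≤ _ := by gcongr
  refine h4.trans ?_
  rw [← Real.exp_add]
  refine Real.exp_le_exp.2 ?_
  nlinarith [mul_le_mul_of_nonneg_right hr hl]

/-! ### The image of a random function -/

/-- The mean of `φ` over the number of values of a uniformly random function. -/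
noncomputable def imageMean (N P : ℕ) (φ : ℕ → ℝ) : ℝ :=
  (∑ f : Fin N → Fin P, φ (Finset.univ.image f).card) / (P : ℝ) ^ N

lemma imageMean_mono {N P : ℕ} {φ ψ : ℕ → ℝ} (h : ∀ u ≤ N, u ≤ P → φ u ≤ ψ u) :
    imageMean N P φ ≤ imageMean N P ψ := by
  unfold imageMean
  gcongr with f
  refine h _ ?_ ?_
  · simpa using Finset.card_image_le (s := (Finset.univ : Finset (Fin N))) (f := f)
  · simpa using Finset.card_le_univ (Finset.univ.image f)

lemma imageMean_const {N P : ℕ} (hP : 0 < P) (c : ℝ) : imageMean N P (fun _ => c) = c := by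
  have : (P : ℝ) ^ N ≠ 0 := by positivity
  simp [imageMean, mul_comm, this]

lemma imageMean_add {N P : ℕ} (φ ψ : ℕ → ℝ) :
    imageMean N P (fun u => φ u + ψ u) = imageMean N P φ + imageMean N P ψ := by
  simp [imageMean, Finset.sum_add_distrib, add_div]

lemma imageMean_const_mul {N P : ℕ} (c : ℝ) (φ : ℕ → ℝ) :
    imageMean N P (fun u => c * φ u) = c * imageMean N P φ := by
  simp [imageMean, ← Finset.mul_sum, mul_div_assoc]

/-- The `(k + 1)`-st value collides with an earlier one with probability at most `k / P`, so it
multiplies the generating function of the number of collisions by at most `1 + z * M / P`. -/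
lemma sum_pow_sub_card_image_le (P : ℕ) {z : ℝ} (hz : 1 ≤ z) (M : ℕ) :
    ∀ N ≤ M, ∑ f : Fin N → Fin P, z ^ (N - (Finset.univ.image f).card) ≤ (P + z * M) ^ N
  | 0, _ => by simp
  | N + 1, hN => by
    rw [← (Fin.consEquiv (fun _ => Fin P)).sum_comp, Fintype.sum_prod_type, Finset.sum_comm,
      pow_succ]
    have hstep : ∀ f : Fin N → Fin P, ∑ x : Fin P,
        z ^ (N + 1 - (Finset.univ.image ((Fin.consEquiv (fun _ => Fin P)) (x, f))).card) ≤
        z ^ (N - (Finset.univ.image f).card) * (P + z * M) := by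
      intro f
      have hle : (Finset.univ.image f).card ≤ N := by
        simpa using Finset.card_image_le (s := (Finset.univ : Finset (Fin N))) (f := f)
      have himg : ∀ x : Fin P, Finset.univ.image ((Fin.consEquiv (fun _ => Fin P)) (x, f)) =
          insert x (Finset.univ.image f) := by
        intro x; ext y; simp [Fin.consEquiv, Fin.exists_fin_succ, eq_comm]
      calc _ ≤ ∑ x : Fin P, z ^ (N - (Finset.univ.image f).card) *
            (1 + if x ∈ Finset.univ.image f then z else 0) := by
            refine Finset.sum_le_sum fun x _ => ?_
            rw [himg]
            by_cases hx : x ∈ Finset.univ.image f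
            · rw [Finset.insert_eq_of_mem hx, if_pos hx,
                show N + 1 - (Finset.univ.image f).card =
                  N - (Finset.univ.image f).card + 1 by omega,
                pow_succ]
              have : (0 : ℝ) ≤ z ^ (N - (Finset.univ.image f).card) := by positivity
              nlinarith
            · rw [Finset.card_insert_of_notMem hx, if_neg hx, Nat.add_sub_add_right]
              simp
        _ = z ^ (N - (Finset.univ.image f).card) * (P + z * (Finset.univ.image f).card) := by
            rw [← Finset.mul_sum, Finset.sum_add_distrib]
            congr 2
            · simp
            · rw [Finset.sum_ite_mem, Finset.univ_inter, Finset.sum_const, nsmul_eq_mul, mul_comm]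
        _ ≤ _ := by
            have : ((Finset.univ.image f).card : ℝ) ≤ M := by
              exact_mod_cast hle.trans (by omega)
            gcongr
    refine (Finset.sum_le_sum fun f _ => hstep f).trans ?_
    rw [← Finset.sum_mul]
    gcongr
    exact sum_pow_sub_card_image_le P hz M N (by omega)

/-- The number of collisions among `N` random values has small exponential moments as long as
`N ^ 2` is small compared with `P`. -/
lemma imageMean_pow_le {N P : ℕ} (hP : 0 < P) {z : ℝ} (hz : 1 ≤ z) :
    imageMean N P (fun u => z ^ (N - u)) ≤ Real.exp (z * N ^ 2 / P) := by
  have hP' : (0 : ℝ) < P := by exact_mod_cast hP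
  unfold imageMean
  rw [div_le_iff₀ (by positivity)]
  refine (sum_pow_sub_card_image_le P hz N N le_rfl).trans ?_
  have h1 : (P : ℝ) + z * N = (1 + z * N / P) * P := by field_simp
  rw [h1, mul_pow]
  gcongr
  calc (1 + z * N / P) ^ N ≤ (Real.exp (z * N / P)) ^ N :=
        pow_le_pow_left₀ (by positivity) (by linarith [Real.add_one_le_exp (z * N / P)]) _
    _ = _ := by rw [← Real.exp_nat_mul]; congr 1; ring

lemma card_image_card_le (N P u : ℕ) (hu : u ≤ P) :
    ((Finset.univ.filter fun f : Fin N → Fin P => (Finset.univ.image f).card ≤ u).card) ≤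
      P.choose u * u ^ N := by
  calc _ ≤ ((Finset.powersetCard u (Finset.univ : Finset (Fin P))).biUnion fun S =>
        Fintype.piFinset fun _ : Fin N => S).card := by
        refine Finset.card_le_card fun f hf => ?_
        obtain ⟨S, hS, hc⟩ := Finset.exists_superset_card_eq (Finset.mem_filter.1 hf).2
          (by simpa using hu)
        refine Finset.mem_biUnion.2 ⟨S, by simp [Finset.mem_powersetCard, hc], ?_⟩
        exact Fintype.mem_piFinset.2 fun i => hS (Finset.mem_image_of_mem f (Finset.mem_univ i))
    _ ≤ ∑ S ∈ Finset.powersetCard u (Finset.univ : Finset (Fin P)), u ^ N := by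
        refine Finset.card_biUnion_le.trans (Finset.sum_le_sum fun S hS => ?_)
        rw [Fintype.card_piFinset, Finset.prod_const, (Finset.mem_powersetCard.1 hS).2]
        simp
    _ = _ := by simp

/-- The lower tail of the number of values of a random function, from the union bound over the sets
of `⌊u₀⌋` values. -/
lemma imageMean_le_tail {N P : ℕ} (hP : 0 < P) (hN : 0 < N) {ε L u₀ : ℝ} (hε : 0 ≤ ε) (hL : 0 ≤ L)
    (h1 : u₀ ≤ P * Real.exp (-L)) (h2 : u₀ ≤ (1 - ε) * N) :
    imageMean N P (fun u => if (u : ℝ) ≤ u₀ then 1 else 0) ≤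
      Real.exp (N * (1 - ε * L)) := by
  have hP' : (0 : ℝ) < P := by exact_mod_cast hP
  have hN' : (0 : ℝ) < N := by exact_mod_cast hN
  unfold imageMean
  rw [div_le_iff₀ (by positivity), Finset.sum_boole]
  rcases lt_or_ge u₀ 1 with hu0 | hu1
  · rw [Finset.filter_eq_empty_iff.2, Finset.card_empty, Nat.cast_zero]
    · positivity
    intro f _ hf
    have : (Finset.univ.image f).Nonempty :=
      ⟨f ⟨0, hN⟩, Finset.mem_image_of_mem f (Finset.mem_univ _)⟩
    have : (1 : ℝ) ≤ (Finset.univ.image f).card := by exact_mod_cast this.card_pos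
    linarith
  set u := ⌊u₀⌋₊ with hu
  have hupos : 0 < u := Nat.floor_pos.2 hu1
  have hule : (u : ℝ) ≤ u₀ := Nat.floor_le (by linarith)
  have hu' : (0 : ℝ) < u := by exact_mod_cast hupos
  have huP : u ≤ P := by
    have : (u : ℝ) ≤ P := hule.trans (h1.trans (by
      have : Real.exp (-L) ≤ 1 := Real.exp_le_one_iff.2 (by linarith)
      nlinarith))
    exact_mod_cast this
  have hεN : ε * N ≤ N - u := by linarith
  have hcast : ((Finset.univ.filter fun f : Fin N → Fin P =>
      ((Finset.univ.image f).card : ℝ) ≤ u₀).card : ℝ) ≤ P.choose u * (u : ℝ) ^ N := by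
    have h3 : (Finset.univ.filter fun f : Fin N → Fin P =>
        ((Finset.univ.image f).card : ℝ) ≤ u₀) =
        Finset.univ.filter fun f : Fin N → Fin P => (Finset.univ.image f).card ≤ u := by
      refine Finset.filter_congr fun f _ => ?_
      rw [hu, Nat.le_floor_iff (by linarith)]
    rw [h3]
    exact_mod_cast card_image_card_le N P u huP
  refine hcast.trans ?_
  have huN' : u ≤ N := by
    have : (u : ℝ) ≤ N := by nlinarith
    exact_mod_cast this
  have hx : (u : ℝ) / P ≤ Real.exp (-L) := by
    rw [div_le_iff₀ hP']; linarith
  calc (P.choose u : ℝ) * (u : ℝ) ^ N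
      ≤ Real.exp u * ((P : ℝ) / u) ^ u * (u : ℝ) ^ N := by
        gcongr; exact choose_le_exp hupos
    _ = Real.exp u * ((u : ℝ) / P) ^ (N - u) * (P : ℝ) ^ N := by
        obtain ⟨t, rfl⟩ := Nat.exists_eq_add_of_le huN'
        rw [Nat.add_sub_cancel_left, div_pow, div_pow, pow_add, pow_add]
        field_simp
    _ ≤ Real.exp u * (Real.exp (-L)) ^ (N - u) * (P : ℝ) ^ N := by gcongr
    _ = Real.exp (u - (N - u) * L) * (P : ℝ) ^ N := by
        rw [← Real.exp_nat_mul, ← Real.exp_add, Nat.cast_sub huN']; congr 2; ring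
    _ ≤ _ := by
        gcongr
        nlinarith [mul_le_mul_of_nonneg_right hεN hL]

/-- The decidability instances are implicit, so that they are found by unification. -/
lemma ite_one_zero_congr {p q : Prop} {_ : Decidable p} {_ : Decidable q} (h : p ↔ q) :
    (if p then (1 : ℝ) else 0) = if q then 1 else 0 := by
  simp only [h]

/-! ### Events that force two sets of vertices not to share objects -/

/-- The vertices outside `A` avoid a given family of object sets on `A` independently. -/
lemma sum_avoid_eq {n m : ℕ} (a : Fin (m + 1) → ℝ) (K : Fin (m + 1) → ℕ) (P : ℕ)
    (A : Finset (Fin n)) (φ : ({v // v ∈ A} → VertexChoice m P) → ℝ) :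
    ∑ ω : Fin n → VertexChoice m P, (∏ v, choiceWeight a K P (ω v)) *
      (φ (fun x => ω x) * {ω : Fin n → VertexChoice m P |
        ∀ x ∈ A, ∀ y ∉ A, Disjoint (ω x).2 (ω y).2}.indicator (fun _ => 1) ω) =
    ∑ s : {v // v ∈ A} → VertexChoice m P, (∏ x, choiceWeight a K P (s x)) *
      (φ s * avoidProb a K P (Finset.univ.biUnion fun x => (s x).2).card ^ (n - A.card)) := by
  classical
  have hsplit := sum_prod_mul_split A (choiceWeight a K P)
    (fun s t => φ s * ∏ y, if (t y).1 ∈ Finset.univ ∧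
      Disjoint (t y).2 (Finset.univ.biUnion fun x => (s x).2) then (1 : ℝ) else 0)
  refine Eq.trans (Finset.sum_congr rfl fun ω _ => ?_) (hsplit.trans ?_)
  · congr 2
    rw [Finset.prod_ite_zero, Finset.prod_const_one, Set.indicator_apply]
    refine ite_one_zero_congr ?_
    simp only [Set.mem_ofPred_eq, Finset.mem_univ, true_and, Finset.disjoint_biUnion_right,
      Subtype.forall, forall_true_left]
    exact ⟨fun h y hy x hx => (h x hx y hy).symm, fun h x hx y hy => (h y hy x hx).symm⟩
  · refine Finset.sum_congr rfl fun s _ => ?_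
    congr 1
    have h1 := sum_prod_mul_prod (ι := {v // v ∉ A}) (choiceWeight a K P)
      (fun _ c => if c.1 ∈ Finset.univ ∧
        Disjoint c.2 (Finset.univ.biUnion fun x => (s x).2) then (1 : ℝ) else 0)
    rw [Finset.prod_const, sum_choiceWeight_avoid, Finset.card_univ,
      Fintype.card_subtype_compl, Fintype.card_fin, Fintype.card_coe] at h1
    rw [avoidProb, ← h1, Finset.mul_sum]
    exact Finset.sum_congr rfl fun t _ => by ring

lemma avoidProb_nonneg {m : ℕ} {a : Fin (m + 1) → ℝ} (ha : ∀ i, 0 < a i)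
    (K : Fin (m + 1) → ℕ) (P u : ℕ) : 0 ≤ avoidProb a K P u :=
  Finset.sum_nonneg fun j _ => mul_nonneg (ha j).le (by positivity)

lemma avoidProb_le_pow {m : ℕ} {a : Fin (m + 1) → ℝ} (ha : ∀ i, 0 < a i) (hs : ∑ i, a i = 1)
    {K : Fin (m + 1) → ℕ} {P : ℕ} (hK : ∀ i, K i ≤ P) (hK0 : ∀ i, K 0 ≤ K i) {u : ℕ}
    (hu : u ≤ P) : avoidProb a K P u ≤ (1 - (u : ℝ) / P) ^ K 0 := by
  have h1 : (0 : ℝ) ≤ 1 - (u : ℝ) / P := by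
    rw [sub_nonneg]; exact div_le_one_of_le₀ (by exact_mod_cast hu) (by positivity)
  have h2 : 1 - (u : ℝ) / P ≤ 1 := by
    have : (0 : ℝ) ≤ (u : ℝ) / P := by positivity
    linarith
  calc avoidProb a K P u ≤ ∑ j, a j * (1 - (u : ℝ) / P) ^ K 0 :=
        Finset.sum_le_sum fun j _ => mul_le_mul_of_nonneg_left
          ((choose_ratio_le_pow hu (hK j)).trans (pow_le_pow_of_le_one h1 h2 (hK0 j))) (ha j).le
    _ = _ := by rw [← Finset.sum_mul, hs, one_mul]

/-- The probability that the vertices of `B` are in groups of `D` and share no object with the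
vertices of `A`. Given the objects of `B`, the objects of `A` avoid them with at most the
probability with which `A.card * K 0` uniformly random objects do; exchanging the order of
integration leaves the vertices of `B`, which have to avoid these random objects. -/
lemma choicesLaw_separated_le {n m : ℕ} {a : Fin (m + 1) → ℝ} (ha : ∀ i, 0 < a i)
    (hs : ∑ i, a i = 1) {K : Fin (m + 1) → ℕ} {P : ℕ} (hP : 0 < P) (hK : ∀ i, K i ≤ P)
    (hK0 : ∀ i, K 0 ≤ K i) {A B : Finset (Fin n)} (hAB : Disjoint A B)
    (D : Finset (Fin (m + 1))) :
    (choicesLaw n a K P).real {ω | (∀ y ∈ B, (ω y).1 ∈ D) ∧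
        ∀ x ∈ A, ∀ y ∈ B, Disjoint (ω x).2 (ω y).2} ≤
      imageMean (A.card * K 0) P (fun u =>
        (∑ j ∈ D, a j * (((P - u).choose (K j) : ℝ) / (P.choose (K j) : ℝ))) ^ B.card) := by
  classical
  set w := choiceWeight a K P with hw
  have hw0 : ∀ c, 0 ≤ w c := choiceWeight_nonneg ha K P
  set N := A.card * K 0 with hN
  have hP' : (0 : ℝ) < P := by exact_mod_cast hP
  -- the objects used by the vertices of `B`
  let V : ({v // v ∉ A} → VertexChoice m P) → Finset (Fin P) := fun t =>
    (Finset.univ.filter fun y : {v // v ∉ A} => y.1 ∈ B).biUnion fun y => (t y).2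
  let G : ({v // v ∉ A} → VertexChoice m P) → ℝ := fun t =>
    if ∀ y, y.1 ∈ B → (t y).1 ∈ D then 1 else 0
  have hG0 : ∀ t, 0 ≤ G t := fun t => by simp only [G]; split_ifs <;> norm_num
  have hBA : ∀ y ∈ B, y ∉ A := fun y hy hyA => Finset.disjoint_left.1 hAB hyA hy
  have hsplit := sum_prod_mul_split A w (fun s t => G t *
    ∏ x, if (s x).1 ∈ Finset.univ ∧ Disjoint (s x).2 (V t) then (1 : ℝ) else 0)
  have h1 : (choicesLaw n a K P).real {ω | (∀ y ∈ B, (ω y).1 ∈ D) ∧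
        ∀ x ∈ A, ∀ y ∈ B, Disjoint (ω x).2 (ω y).2} =
      ∑ t, (∏ i, w (t i)) * (G t * avoidProb a K P (V t).card ^ A.card) := by
    rw [choicesLaw_real_eq ha hs hK]
    refine Eq.trans (Finset.sum_congr rfl fun ω _ => ?_) (hsplit.trans ?_)
    · congr 1
      rw [Finset.prod_ite_zero, Finset.prod_const_one, Set.indicator_apply, mul_ite, mul_one,
        mul_zero, ← ite_and]
      refine ite_one_zero_congr ?_
      simp only [Set.mem_ofPred_eq, Finset.mem_univ, true_and, V, Finset.disjoint_biUnion_right,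
        Subtype.forall, forall_true_left, Finset.mem_filter]
      constructor
      · rintro ⟨h, h'⟩
        exact ⟨fun x hx y _ hyB => h' x hx y hyB, fun y _ hyB => h y hyB⟩
      · rintro ⟨h, h'⟩
        exact ⟨fun y hyB => h' y (hBA y hyB) hyB, fun x hx y hyB => h x hx y (hBA y hyB) hyB⟩
    · have h2 : ∀ t, ∑ s : {v // v ∈ A} → VertexChoice m P, (∏ i, w (s i)) *
          ∏ x, (if (s x).1 ∈ Finset.univ ∧ Disjoint (s x).2 (V t) then (1 : ℝ) else 0) =
          avoidProb a K P (V t).card ^ A.card := fun t => by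
        rw [sum_prod_mul_prod (ι := {v // v ∈ A}) w (fun _ c => if c.1 ∈ Finset.univ ∧
          Disjoint c.2 (V t) then (1 : ℝ) else 0), Finset.prod_const, sum_choiceWeight_avoid,
          Finset.card_univ, Fintype.card_coe, avoidProb]
      simp_rw [← h2, Finset.mul_sum]
      rw [Finset.sum_comm]
      exact Finset.sum_congr rfl fun t _ => Finset.sum_congr rfl fun s _ => by ring
  have h3 : ∀ t, avoidProb a K P (V t).card ^ A.card ≤
      (∑ f : Fin N → Fin P, if Disjoint (Finset.univ.image f) (V t) then (1 : ℝ) else 0) /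
        (P : ℝ) ^ N := by
    intro t
    have hV : (V t).card ≤ P := by simpa using Finset.card_le_univ (V t)
    refine (pow_le_pow_left₀ (avoidProb_nonneg ha K P _)
      (avoidProb_le_pow ha hs hK hK0 hV) _).trans (le_of_eq ?_)
    have h4 : (Finset.univ.filter fun f : Fin N → Fin P =>
        Disjoint (Finset.univ.image f) (V t)) = Fintype.piFinset fun _ => (V t)ᶜ := by
      ext f
      simp [Finset.disjoint_left]
    rw [Finset.sum_boole, h4, Fintype.card_piFinset, Finset.prod_const, Finset.card_univ,
      Fintype.card_fin, Finset.card_compl, Fintype.card_fin, Nat.cast_pow, Nat.cast_sub hV,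
      ← div_pow, ← pow_mul, mul_comm (K 0), hN, one_sub_div hP'.ne']
  have h5 : ∀ f : Fin N → Fin P, ∑ t, (∏ i, w (t i)) *
      (G t * if Disjoint (Finset.univ.image f) (V t) then (1 : ℝ) else 0) =
      (∑ j ∈ D, a j * (((P - (Finset.univ.image f).card).choose (K j) : ℝ) /
        (P.choose (K j) : ℝ))) ^ B.card := by
    intro f
    have h6 := sum_prod_mul_prod (ι := {v // v ∉ A}) w (fun y c =>
      if y.1 ∈ B then (if c.1 ∈ D ∧ Disjoint c.2 (Finset.univ.image f) then (1 : ℝ) else 0) else 1)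
    have h7 : ∀ y : {v // v ∉ A}, ∑ c, w c *
        (if y.1 ∈ B then (if c.1 ∈ D ∧ Disjoint c.2 (Finset.univ.image f) then (1 : ℝ) else 0)
          else 1) = if y.1 ∈ B then
          (∑ j ∈ D, a j * (((P - (Finset.univ.image f).card).choose (K j) : ℝ) /
          (P.choose (K j) : ℝ))) else 1 := by
      intro y
      by_cases hy : y.1 ∈ B
      · simp only [hy, if_true]
        exact sum_choiceWeight_avoid a K P D _
      · simp only [hy, if_false, mul_one]
        exact sum_choiceWeight hs hK
    have hcard : (Finset.univ.filter fun y : {v // v ∉ A} => y.1 ∈ B).card = B.card := by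
      refine Finset.card_bij (fun y _ => y.1) (fun y hy => (Finset.mem_filter.1 hy).2)
        (fun y _ z _ h => Subtype.ext h) fun y hy => ⟨⟨y, hBA y hy⟩, by simp [hy], rfl⟩
    rw [Finset.prod_congr rfl fun y _ => h7 y, Finset.prod_ite, Finset.prod_const,
      Finset.prod_const_one, mul_one, hcard] at h6
    rw [← h6]
    refine Finset.sum_congr rfl fun t _ => ?_
    congr 1
    rw [← Finset.prod_filter, Finset.prod_ite_zero, Finset.prod_const_one]
    simp only [G, mul_ite, mul_one, mul_zero, V, ← ite_and]
    refine ite_one_zero_congr ?_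
    simp only [Finset.mem_filter, Finset.mem_univ, true_and, Finset.disjoint_biUnion_right]
    exact ⟨fun h y hy => ⟨h.2 y hy, (h.1 y hy).symm⟩,
      fun h => ⟨fun y hy => (h y hy).2.symm, fun y hy => (h y hy).1⟩⟩
  rw [h1]
  calc _ ≤ ∑ t, (∏ i, w (t i)) * (G t *
        ((∑ f : Fin N → Fin P, if Disjoint (Finset.univ.image f) (V t) then (1 : ℝ) else 0) /
        (P : ℝ) ^ N)) := by
        refine Finset.sum_le_sum fun t _ => mul_le_mul_of_nonneg_left
          (mul_le_mul_of_nonneg_left (h3 t) (hG0 t)) (Finset.prod_nonneg fun i _ => hw0 _)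
    _ = _ := by
        unfold imageMean
        rw [← Finset.sum_congr rfl fun f _ => h5 f, Finset.sum_comm, Finset.sum_div]
        refine Finset.sum_congr rfl fun t _ => ?_
        rw [← Finset.mul_sum, ← Finset.mul_sum]
        ring

/-- The event that all vertices of `A` are isolated and belong to group `0`. -/
def isolatedEvent {n m P : ℕ} (A : Finset (Fin n)) : Set (Fin n → VertexChoice m P) :=
  {ω | ∀ x ∈ A, (ω x).1 = 0 ∧ ∀ y, y ≠ x → Disjoint (ω x).2 (ω y).2}

lemma sum_choiceWeight_group {m : ℕ} {a : Fin (m + 1) → ℝ} {K : Fin (m + 1) → ℕ} {P : ℕ}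
    (hK : ∀ i, K i ≤ P) (i : Fin (m + 1)) :
    ∑ c, choiceWeight a K P c * (if c.1 = i then 1 else 0) = a i := by
  classical
  have h := sum_choiceWeight_avoid a K P {i} ∅
  have h0 : (P.choose (K i) : ℝ) ≠ 0 := by exact_mod_cast (Nat.choose_pos (hK i)).ne'
  simpa [h0] using h

lemma choicesLaw_isolated_le {n m : ℕ} {a : Fin (m + 1) → ℝ} (ha : ∀ i, 0 < a i)
    (hs : ∑ i, a i = 1) {K : Fin (m + 1) → ℕ} {P : ℕ} (hK : ∀ i, K i ≤ P)
    (A : Finset (Fin n)) :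
    (choicesLaw n a K P).real (isolatedEvent A) ≤
      a 0 ^ A.card * avoidProb a K P (A.card * K 0) ^ (n - A.card) := by
  classical
  have hw0 : ∀ c, 0 ≤ choiceWeight a K P c := choiceWeight_nonneg ha K P
  let φ : ({v // v ∈ A} → VertexChoice m P) → ℝ := fun s =>
    if (∀ x, (s x).1 = 0) ∧ ∀ x y, y ≠ x → Disjoint (s x).2 (s y).2 then 1 else 0
  have h1 : (choicesLaw n a K P).real (isolatedEvent A) =
      ∑ ω : Fin n → VertexChoice m P, (∏ v, choiceWeight a K P (ω v)) *
      (φ (fun x => ω x) * {ω : Fin n → VertexChoice m P |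
        ∀ x ∈ A, ∀ y ∉ A, Disjoint (ω x).2 (ω y).2}.indicator (fun _ => 1) ω) := by
    rw [choicesLaw_real_eq ha hs hK]
    refine Finset.sum_congr rfl fun ω _ => ?_
    congr 1
    simp only [φ, Set.indicator_apply, ite_mul, one_mul, zero_mul, ← ite_and]
    refine ite_one_zero_congr ?_
    simp only [isolatedEvent, Set.mem_ofPred_eq, Subtype.forall, ne_eq, Subtype.mk.injEq]
    constructor
    · intro h
      exact ⟨⟨fun x hx => (h x hx).1, fun x hx y hy hxy => (h x hx).2 y hxy⟩,
        fun x hx y hy => (h x hx).2 y fun e => hy (e ▸ hx)⟩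
    · rintro ⟨⟨h2, h3⟩, h4⟩ x hx
      refine ⟨h2 x hx, fun y hy => ?_⟩
      by_cases hyA : y ∈ A
      · exact h3 x hx y hyA hy
      · exact h4 x hx y hyA
  rw [h1, sum_avoid_eq]
  have h5 := sum_prod_mul_prod (ι := {v // v ∈ A}) (choiceWeight a K P)
    (fun _ c => if c.1 = 0 then (1 : ℝ) else 0)
  rw [sum_choiceWeight_group hK, Finset.prod_const, Finset.card_univ, Fintype.card_coe] at h5
  rw [← h5, Finset.sum_mul]
  refine Finset.sum_le_sum fun s _ => ?_
  rw [mul_assoc]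
  by_cases h : (∀ x, choiceWeight a K P (s x) ≠ 0)
  · refine mul_le_mul_of_nonneg_left ?_ (Finset.prod_nonneg fun i _ => hw0 _)
    simp only [φ]
    split_ifs with hφ
    · have hcard : (Finset.univ.biUnion fun x => (s x).2).card = A.card * K 0 := by
        rw [Finset.card_biUnion fun x _ y _ hxy => hφ.2 x y hxy.symm]
        have : ∀ x, (s x).2.card = K 0 := fun x => by
          by_contra hne
          exact h x (by rw [choiceWeight, hφ.1 x, if_neg hne])
        simp [this]
      rw [hcard]
      simp [hφ.1]
    · rw [zero_mul]
      exact mul_nonneg (Finset.prod_nonneg fun i _ => by split_ifs <;> norm_num)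
        (pow_nonneg (avoidProb_nonneg ha K P _) _)
  · push Not at h
    obtain ⟨x, hx⟩ := h
    rw [Finset.prod_eq_zero (Finset.mem_univ x) hx, zero_mul, zero_mul]

lemma choicesLaw_isolated_singleton {n m : ℕ} {a : Fin (m + 1) → ℝ} (ha : ∀ i, 0 < a i)
    (hs : ∑ i, a i = 1) {K : Fin (m + 1) → ℕ} {P : ℕ} (hK : ∀ i, K i ≤ P) (v : Fin n) :
    (choicesLaw n a K P).real (isolatedEvent {v}) = a 0 * avoidProb a K P (K 0) ^ (n - 1) := by
  classical
  let φ : ({u // u ∈ ({v} : Finset (Fin n))} → VertexChoice m P) → ℝ := fun s =>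
    ∏ x, if (s x).1 = 0 then 1 else 0
  have h1 : (choicesLaw n a K P).real (isolatedEvent {v}) =
      ∑ ω : Fin n → VertexChoice m P, (∏ v, choiceWeight a K P (ω v)) *
      (φ (fun x => ω x) * {ω : Fin n → VertexChoice m P |
        ∀ x ∈ ({v} : Finset (Fin n)), ∀ y ∉ ({v} : Finset (Fin n)),
          Disjoint (ω x).2 (ω y).2}.indicator (fun _ => 1) ω) := by
    rw [choicesLaw_real_eq ha hs hK]
    refine Finset.sum_congr rfl fun ω _ => ?_
    congr 1
    simp only [φ, Set.indicator_apply, Finset.prod_ite_zero, ite_mul, Finset.prod_const_one,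
      one_mul, zero_mul, ← ite_and]
    refine ite_one_zero_congr ?_
    simp [isolatedEvent]
  rw [h1, sum_avoid_eq]
  have h5 := sum_prod_mul_prod (ι := {u // u ∈ ({v} : Finset (Fin n))}) (choiceWeight a K P)
    (fun _ c => if c.1 = 0 then (1 : ℝ) else 0)
  rw [sum_choiceWeight_group hK, Finset.prod_const, Finset.card_univ, Fintype.card_coe,
    Finset.card_singleton, pow_one] at h5
  rw [← h5, Finset.sum_mul]
  refine Finset.sum_congr rfl fun s _ => ?_
  rw [mul_assoc]
  by_cases h : (∀ x, choiceWeight a K P (s x) ≠ 0)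
  · congr 1
    simp only [φ, Finset.card_singleton]
    by_cases hφ : ∀ x, (s x).1 = 0
    · have hcard : (Finset.univ.biUnion fun x => (s x).2).card = K 0 := by
        have : ∀ x, (s x).2.card = K 0 := fun x => by
          by_contra hne
          exact h x (by rw [choiceWeight, hφ x, if_neg hne])
        simp [Finset.univ_unique, this]
      rw [hcard]
    · rw [Finset.prod_ite_zero, if_neg fun h => hφ fun x => h x (Finset.mem_univ x), zero_mul,
        zero_mul]
  · push Not at h
    obtain ⟨x, hx⟩ := h
    rw [Finset.prod_eq_zero (Finset.mem_univ x) hx, zero_mul, zero_mul]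

/-! ### Estimates for the probability of avoiding a set of objects -/

/-- The mean size of the object set of a vertex. -/
noncomputable def meanSize {m : ℕ} (a : Fin (m + 1) → ℝ) (K : Fin (m + 1) → ℕ) : ℝ :=
  ∑ j, a j * K j

/-- The mean number of objects shared by a vertex of group `0` and an arbitrary vertex. -/
noncomputable def overlapMean {m : ℕ} (a : Fin (m + 1) → ℝ) (K : Fin (m + 1) → ℕ) (P : ℕ) : ℝ :=
  K 0 * meanSize a K / P

/-- The upper bound for `avoidProb` in which every binomial ratio is replaced by an exponential. -/
noncomputable def expAvoid {m : ℕ} (a : Fin (m + 1) → ℝ) (K : Fin (m + 1) → ℕ) (P : ℕ)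
    (u : ℝ) : ℝ :=
  ∑ j, a j * Real.exp (-(u * K j / P))

/-- The constant of the quadratic error term in the expansion of `expAvoid`. -/
noncomputable def quadConst {m : ℕ} (a : Fin (m + 1) → ℝ) : ℝ := (∑ j, (a j)⁻¹) / 2

lemma quadConst_pos {m : ℕ} {a : Fin (m + 1) → ℝ} (ha : ∀ i, 0 < a i) : 0 < quadConst a :=
  half_pos (Finset.sum_pos (fun i _ => inv_pos.2 (ha i)) Finset.univ_nonempty)

lemma meanSize_nonneg {m : ℕ} {a : Fin (m + 1) → ℝ} (ha : ∀ i, 0 < a i) (K : Fin (m + 1) → ℕ) :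
    0 ≤ meanSize a K :=
  Finset.sum_nonneg fun j _ => mul_nonneg (ha j).le (by positivity)

lemma overlapMean_nonneg {m : ℕ} {a : Fin (m + 1) → ℝ} (ha : ∀ i, 0 < a i)
    (K : Fin (m + 1) → ℕ) (P : ℕ) : 0 ≤ overlapMean a K P :=
  div_nonneg (mul_nonneg (Nat.cast_nonneg _) (meanSize_nonneg ha K)) (Nat.cast_nonneg _)

lemma le_meanSize {m : ℕ} {a : Fin (m + 1) → ℝ} (ha : ∀ i, 0 < a i) (hs : ∑ i, a i = 1)
    {K : Fin (m + 1) → ℕ} (hK0 : ∀ i, K 0 ≤ K i) : (K 0 : ℝ) ≤ meanSize a K := by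
  calc (K 0 : ℝ) = ∑ j, a j * K 0 := by rw [← Finset.sum_mul, hs, one_mul]
    _ ≤ _ := Finset.sum_le_sum fun j _ => mul_le_mul_of_nonneg_left
        (by exact_mod_cast hK0 j) (ha j).le

lemma meanSize_le {m : ℕ} {a : Fin (m + 1) → ℝ} (ha : ∀ i, 0 < a i) (hs : ∑ i, a i = 1)
    {K : Fin (m + 1) → ℕ} {k : ℕ} (hk : ∀ i, K i ≤ k) : meanSize a K ≤ k := by
  calc _ ≤ ∑ j, a j * (k : ℝ) := Finset.sum_le_sum fun j _ => mul_le_mul_of_nonneg_left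
        (by exact_mod_cast hk j) (ha j).le
    _ = k := by rw [← Finset.sum_mul, hs, one_mul]

lemma expAvoid_anti {m : ℕ} {a : Fin (m + 1) → ℝ} (ha : ∀ i, 0 < a i)
    (K : Fin (m + 1) → ℕ) (P : ℕ) : Antitone (expAvoid a K P) := fun u v huv =>
  Finset.sum_le_sum fun j _ => mul_le_mul_of_nonneg_left (Real.exp_le_exp.2 (by
    rw [neg_le_neg_iff]; gcongr)) (ha j).le

lemma expAvoid_le_one {m : ℕ} {a : Fin (m + 1) → ℝ} (ha : ∀ i, 0 < a i) (hs : ∑ i, a i = 1)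
    (K : Fin (m + 1) → ℕ) (P : ℕ) {u : ℝ} (hu : 0 ≤ u) : expAvoid a K P u ≤ 1 :=
  (expAvoid_anti ha K P hu).trans (by simp [expAvoid, hs])

lemma avoidProb_le_expAvoid {m : ℕ} {a : Fin (m + 1) → ℝ} (ha : ∀ i, 0 < a i)
    {K : Fin (m + 1) → ℕ} {P u : ℕ} (hK : ∀ i, K i ≤ P) (hu : u ≤ P) :
    avoidProb a K P u ≤ expAvoid a K P u :=
  Finset.sum_le_sum fun j _ => mul_le_mul_of_nonneg_left (choose_ratio_le_exp hu (hK j)) (ha j).le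

lemma expAvoid_le {m : ℕ} {a : Fin (m + 1) → ℝ} (ha : ∀ i, 0 < a i) (hs : ∑ i, a i = 1)
    (K : Fin (m + 1) → ℕ) (P : ℕ) {u y : ℝ} (hu : 0 ≤ u) (hy : y = u * meanSize a K / P) :
    expAvoid a K P u ≤ 1 - y + quadConst a * y ^ 2 := by
  have hx : ∀ j, 0 ≤ u * K j / P := fun j => by positivity
  have hsum : ∑ j, a j * (u * K j / P) = y := by
    rw [hy, meanSize, Finset.mul_sum, Finset.sum_div]
    exact Finset.sum_congr rfl fun j _ => by ring
  have hj : ∀ j, a j * Real.exp (-(u * K j / P)) ≤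
      a j - a j * (u * K j / P) + (a j)⁻¹ * y ^ 2 / 2 := fun j => by
    have h1 : a j * (u * K j / P) ≤ y := by
      rw [← hsum]
      exact Finset.single_le_sum (f := fun j => a j * (u * K j / P))
        (fun i _ => mul_nonneg (ha i).le (hx i)) (Finset.mem_univ j)
    have h2 : a j * (u * K j / P) ^ 2 ≤ (a j)⁻¹ * y ^ 2 := by
      rw [inv_mul_eq_div, le_div_iff₀ (ha j)]
      calc _ = (a j * (u * K j / P)) ^ 2 := by ring
        _ ≤ y ^ 2 := pow_le_pow_left₀ (mul_nonneg (ha j).le (hx j)) h1 2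
    have := mul_le_mul_of_nonneg_left (exp_neg_le_quadratic (hx j)) (ha j).le
    linarith
  calc expAvoid a K P u ≤ ∑ j, (a j - a j * (u * K j / P) + (a j)⁻¹ * y ^ 2 / 2) :=
        Finset.sum_le_sum fun j _ => hj j
    _ = _ := by
        rw [Finset.sum_add_distrib, Finset.sum_sub_distrib, hs, hsum, ← Finset.sum_div,
          ← Finset.sum_mul, quadConst]
        ring

lemma one_sub_avoidProb_le {m : ℕ} {a : Fin (m + 1) → ℝ} (ha : ∀ i, 0 < a i)
    (hs : ∑ i, a i = 1) {K : Fin (m + 1) → ℕ} {P : ℕ} (hK : ∀ i, K i ≤ P) (h1 : 1 ≤ K 0) :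
    1 - avoidProb a K P (K 0) ≤ overlapMean a K P := by
  have : ∑ j, a j * (1 - (K 0 : ℝ) * K j / P) ≤ avoidProb a K P (K 0) :=
    Finset.sum_le_sum fun j _ => mul_le_mul_of_nonneg_left
      (one_sub_le_choose_ratio h1 (hK j)) (ha j).le
  have h2 : ∑ j, a j * (1 - (K 0 : ℝ) * K j / P) = 1 - overlapMean a K P := by
    simp_rw [mul_sub, Finset.sum_sub_distrib, mul_one, hs, overlapMean, meanSize, Finset.mul_sum,
      Finset.sum_div]
    congr 1
    exact Finset.sum_congr rfl fun j _ => by ring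
  linarith

lemma overlapMean_le {m : ℕ} {a : Fin (m + 1) → ℝ} (ha : ∀ i, 0 < a i)
    (hs : ∑ i, a i = 1) {K : Fin (m + 1) → ℕ} {P : ℕ} (hK : ∀ i, K i ≤ P)
    (hKP : ∀ i, (K 0 : ℝ) * K i ≤ P) :
    overlapMean a K P ≤ 2 * (1 - avoidProb a K P (K 0)) := by
  have hj : ∀ j, a j * (((P - K 0).choose (K j) : ℝ) / (P.choose (K j) : ℝ)) ≤
      a j - a j * ((K 0 : ℝ) * K j / P) / 2 := fun j => by
    have h0 : 0 ≤ (K 0 : ℝ) * K j / P := by positivity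
    have h1 : (K 0 : ℝ) * K j / P ≤ 1 := div_le_one_of_le₀ (hKP j) (by positivity)
    have h2 := (choose_ratio_le_exp (hK 0) (hK j)).trans (exp_neg_le_quadratic h0)
    have := mul_le_mul_of_nonneg_left (h2.trans (by nlinarith :
      _ ≤ 1 - ((K 0 : ℝ) * K j / P) / 2)) (ha j).le
    linarith
  have h2 : overlapMean a K P = ∑ j, a j * ((K 0 : ℝ) * K j / P) := by
    rw [overlapMean, meanSize, Finset.mul_sum, Finset.sum_div]
    exact Finset.sum_congr rfl fun j _ => by ring
  have h3 : avoidProb a K P (K 0) ≤ ∑ j, (a j - a j * ((K 0 : ℝ) * K j / P) / 2) :=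
    Finset.sum_le_sum fun j _ => hj j
  rw [Finset.sum_sub_distrib, hs, ← Finset.sum_div, ← h2] at h3
  linarith

/-! ### Isolated vertices -/

lemma not_connected_of_isolated {n m P : ℕ} (hn : 2 ≤ n) {ω : Fin n → VertexChoice m P}
    {x : Fin n} (hx : ω ∈ isolatedEvent {x}) : ¬ (intersectionGraph ω).Connected := by
  intro h
  have : Nontrivial (Fin n) := Fin.nontrivial_iff_two_le.2 hn
  obtain ⟨y, hy⟩ := exists_ne x
  obtain ⟨p⟩ := h.preconnected x y
  cases p with
  | nil => exact hy rfl
  | @cons _ v _ hadj _ =>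
    have hd := (hx x (Finset.mem_singleton_self x)).2 v hadj.1.symm
    exact Finset.not_disjoint_iff_nonempty_inter.2 hadj.2 hd

/-- Chebyshev's inequality for the number of isolated vertices of group `0`. -/
lemma probConnected_le_of_isolated {n m : ℕ} (hn : 2 ≤ n) {a : Fin (m + 1) → ℝ}
    (ha : ∀ i, 0 < a i) (hs : ∑ i, a i = 1) {K : Fin (m + 1) → ℕ} {P : ℕ} (hK : ∀ i, K i ≤ P)
    (hp : 0 < avoidProb a K P (K 0)) :
    probConnected n a K P ≤ (n * a 0 * avoidProb a K P (K 0) ^ (n - 1))⁻¹ +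
      avoidProb a K P (2 * K 0) ^ (n - 2) / (avoidProb a K P (K 0) ^ (n - 1)) ^ 2 - 1 := by
  classical
  set p := avoidProb a K P (K 0) with hp_def
  set p₂ := avoidProb a K P (2 * K 0) with hp2
  set μ := n * a 0 * p ^ (n - 1) with hμ
  have hn0 : (0 : ℝ) < n := by exact_mod_cast (by omega : 0 < n)
  have hμ0 : 0 < μ := mul_pos (mul_pos hn0 (ha 0)) (pow_pos hp _)
  have hp20 : 0 ≤ p₂ := avoidProb_nonneg ha K P _
  set W : (Fin n → VertexChoice m P) → ℝ := fun ω => ∏ v, choiceWeight a K P (ω v) with hW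
  have hW0 : ∀ ω, 0 ≤ W ω := fun ω => Finset.prod_nonneg fun i _ => choiceWeight_nonneg ha K P _
  have hW1 : ∑ ω, W ω = 1 := by
    have h := sum_prod_mul_prod (ι := Fin n) (choiceWeight a K P) (fun _ _ => 1)
    simp only [Finset.prod_const_one, mul_one, sum_choiceWeight hs hK] at h
    exact h
  set I : Fin n → (Fin n → VertexChoice m P) → ℝ := fun x =>
    (isolatedEvent {x}).indicator (fun _ => 1) with hI
  set Z : (Fin n → VertexChoice m P) → ℝ := fun ω => ∑ x, I x ω with hZ
  have hI1 : ∀ x, ∑ ω, W ω * I x ω = a 0 * p ^ (n - 1) := fun x => by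
    rw [← choicesLaw_real_eq ha hs hK, choicesLaw_isolated_singleton ha hs hK]
  have hZ1 : ∑ ω, W ω * Z ω = μ := by
    simp_rw [hZ, Finset.mul_sum]
    rw [Finset.sum_comm, Finset.sum_congr rfl fun x _ => hI1 x]
    simp [hμ, mul_assoc]
  have hII : ∀ x y, ∑ ω, W ω * (I x ω * I y ω) ≤
      (if x = y then a 0 * p ^ (n - 1) else 0) + a 0 ^ 2 * p₂ ^ (n - 2) := by
    intro x y
    by_cases hxy : x = y
    · subst hxy
      rw [if_pos rfl, ← hI1 x]
      have : ∀ ω, I x ω * I x ω = I x ω := fun ω => by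
        simp only [hI, Set.indicator_apply]; split_ifs <;> simp
      simp_rw [this]
      have : 0 ≤ a 0 ^ 2 * p₂ ^ (n - 2) := by positivity
      linarith
    · rw [if_neg hxy, zero_add]
      have h1 : ∀ ω, I x ω * I y ω = (isolatedEvent {x, y}).indicator (fun _ => 1) ω := fun ω => by
        have h2 : ω ∈ isolatedEvent {x, y} ↔ ω ∈ isolatedEvent {x} ∧ ω ∈ isolatedEvent {y} := by
          simp [isolatedEvent]
        simp only [hI, Set.indicator_apply, h2]
        by_cases h3 : ω ∈ isolatedEvent {x} <;> by_cases h4 : ω ∈ isolatedEvent {y} <;>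
          simp [h3, h4]
      simp_rw [h1]
      rw [← choicesLaw_real_eq ha hs hK]
      have := choicesLaw_isolated_le ha hs hK ({x, y} : Finset (Fin n))
      rwa [Finset.card_pair hxy] at this
  have hZ2 : ∑ ω, W ω * (Z ω) ^ 2 ≤ μ + n ^ 2 * (a 0 ^ 2 * p₂ ^ (n - 2)) := by
    have h1 : ∑ ω, W ω * (Z ω) ^ 2 = ∑ x, ∑ y, ∑ ω, W ω * (I x ω * I y ω) := by
      simp_rw [sq, hZ, Finset.sum_mul_sum, Finset.mul_sum]
      rw [Finset.sum_comm]
      exact Finset.sum_congr rfl fun x _ => Finset.sum_comm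
    rw [h1]
    refine (Finset.sum_le_sum fun x _ => Finset.sum_le_sum fun y _ => hII x y).trans (le_of_eq ?_)
    simp [Finset.sum_add_distrib, hμ]
    ring
  have hvar : probConnected n a K P * μ ^ 2 ≤ ∑ ω, W ω * (Z ω - μ) ^ 2 := by
    rw [probConnected, choicesLaw_real_eq ha hs hK, Finset.sum_mul]
    refine Finset.sum_le_sum fun ω _ => ?_
    rw [mul_assoc]
    refine mul_le_mul_of_nonneg_left ?_ (hW0 ω)
    by_cases hc : ω ∈ {ω | (intersectionGraph ω).Connected}
    · have : Z ω = 0 := Finset.sum_eq_zero fun x _ => Set.indicator_of_notMem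
        (fun hx => not_connected_of_isolated hn hx hc) _
      rw [Set.indicator_of_mem hc, this]
      simp
    · rw [Set.indicator_of_notMem hc, zero_mul]
      positivity
  have hexp : ∑ ω, W ω * (Z ω - μ) ^ 2 = ∑ ω, W ω * (Z ω) ^ 2 - μ ^ 2 := by
    have : ∀ ω, W ω * (Z ω - μ) ^ 2 = W ω * (Z ω) ^ 2 - 2 * μ * (W ω * Z ω) + μ ^ 2 * W ω :=
      fun ω => by ring
    simp_rw [this]
    rw [Finset.sum_add_distrib, Finset.sum_sub_distrib, ← Finset.mul_sum, ← Finset.mul_sum, hZ1,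
      hW1]
    ring
  have h4 : probConnected n a K P * μ ^ 2 ≤ μ + n ^ 2 * (a 0 ^ 2 * p₂ ^ (n - 2)) - μ ^ 2 := by
    linarith
  rw [← le_div_iff₀ (by positivity)] at h4
  refine h4.trans (le_of_eq ?_)
  have ha0 := (ha 0).ne'
  have hpn : p ^ (n - 1) ≠ 0 := (pow_pos hp _).ne'
  rw [sub_div, add_div, div_self (by positivity)]
  congr 2
  · rw [sq, div_mul_cancel_left₀ hμ0.ne']
  · rw [hμ]; field_simp

/-- The bound of `probConnected_le_of_isolated` in terms of the edge probability `b` alone. -/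
lemma probConnected_le_exp {n m : ℕ} (hn : 2 ≤ n) {a : Fin (m + 1) → ℝ}
    (ha : ∀ i, 0 < a i) (hs : ∑ i, a i = 1) {K : Fin (m + 1) → ℕ} {P : ℕ} (hK : ∀ i, K i ≤ P)
    (h2K : 2 * K 0 ≤ P) (hKP : ∀ i, (K 0 : ℝ) * K i ≤ P) (h1 : 1 ≤ K 0) {b : ℝ}
    (hb : b = 1 - avoidProb a K P (K 0)) (hb4 : b ≤ 1 / 4) :
    probConnected n a K P ≤ (a 0)⁻¹ * Real.exp (n * b - Real.log n + n * b ^ 2) +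
      ((1 - b) ^ 2)⁻¹ * Real.exp (64 * quadConst a * (n * b ^ 2)) - 1 := by
  set p := avoidProb a K P (K 0) with hp_def
  have hp : p = 1 - b := by linarith
  have hp0 : 0 < p := by linarith
  have hp1 : p ≤ 1 := (avoidProb_le_expAvoid ha hK (hK 0)).trans
    (expAvoid_le_one ha hs K P (by positivity))
  have hb0 : 0 ≤ b := by linarith
  have hn0 : (0 : ℝ) < n := by exact_mod_cast (by omega : 0 < n)
  have hC := quadConst_pos ha
  refine (probConnected_le_of_isolated hn ha hs hK hp0).trans ?_
  rw [← hp_def]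
  have hθ1 := one_sub_avoidProb_le ha hs hK h1
  have hθ2 := overlapMean_le ha hs hK hKP
  rw [← hp_def, ← hb] at hθ1 hθ2
  set θ := overlapMean a K P with hθ
  gcongr
  · have h5 : Real.exp (-(b + b ^ 2)) ≤ p := by
      refine (exp_neg_le_quadratic (by positivity)).trans ?_
      rw [hp]
      nlinarith [mul_nonneg hb0 hb0, mul_nonneg (mul_nonneg hb0 hb0) hb0]
    have h6 : Real.exp (-(n * (b + b ^ 2))) ≤ p ^ (n - 1) := by
      calc _ = (Real.exp (-(b + b ^ 2))) ^ n := by rw [← Real.exp_nat_mul]; congr 1; ring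
        _ ≤ p ^ n := pow_le_pow_left₀ (Real.exp_pos _).le h5 _
        _ ≤ p ^ (n - 1) := pow_le_pow_of_le_one hp0.le hp1 (by omega)
    have h7 : n * a 0 * Real.exp (-(n * (b + b ^ 2))) ≤ n * a 0 * p ^ (n - 1) := by
      have := ha 0
      gcongr
    have h8 : (n * a 0 * Real.exp (-(n * (b + b ^ 2))))⁻¹ =
        (a 0)⁻¹ * Real.exp (n * b - Real.log n + n * b ^ 2) := by
      rw [show n * b - Real.log n + n * b ^ 2 = n * (b + b ^ 2) - Real.log n by ring,
        Real.exp_sub, Real.exp_log hn0, Real.exp_neg]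
      have := (ha 0).ne'
      field_simp
    rw [← h8]
    have := ha 0
    exact inv_anti₀ (by positivity) h7
  · have h9 : avoidProb a K P (2 * K 0) ≤ p ^ 2 * (1 + 64 * quadConst a * b ^ 2) := by
      refine (avoidProb_le_expAvoid ha hK h2K).trans
        ((expAvoid_le ha hs K P (by positivity) rfl).trans ?_)
      have h10 : ((2 * K 0 : ℕ) : ℝ) * meanSize a K / P = 2 * θ := by
        rw [hθ, overlapMean]; push_cast; ring
      rw [h10, hp]
      have h11 : quadConst a * (2 * θ) ^ 2 ≤ quadConst a * (16 * b ^ 2) := by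
        gcongr; nlinarith
      have h12 : (1 / 4 : ℝ) ≤ (1 - b) ^ 2 := by nlinarith
      have h13 : quadConst a * (16 * b ^ 2) ≤ (1 - b) ^ 2 * (64 * quadConst a * b ^ 2) := by
        have : 0 ≤ 64 * quadConst a * b ^ 2 := by positivity
        nlinarith
      nlinarith
    calc avoidProb a K P (2 * K 0) ^ (n - 2) / (p ^ (n - 1)) ^ 2
        ≤ (p ^ 2 * (1 + 64 * quadConst a * b ^ 2)) ^ (n - 2) / (p ^ (n - 1)) ^ 2 := by
          gcongr
          exact avoidProb_nonneg ha K P _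
      _ = (p ^ 2)⁻¹ * (1 + 64 * quadConst a * b ^ 2) ^ (n - 2) := by
          obtain ⟨k, rfl⟩ := Nat.exists_eq_add_of_le hn
          rw [Nat.add_sub_cancel_left, show 2 + k - 1 = k + 1 by omega, mul_pow, ← pow_mul,
            ← pow_mul, show (k + 1) * 2 = 2 * k + 2 by ring, pow_add]
          field_simp
      _ ≤ (p ^ 2)⁻¹ * Real.exp (64 * quadConst a * (n * b ^ 2)) := by
          gcongr
          calc (1 + 64 * quadConst a * b ^ 2) ^ (n - 2)
              ≤ (1 + 64 * quadConst a * b ^ 2) ^ n :=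
                pow_le_pow_right₀ (by nlinarith [mul_nonneg hC.le (sq_nonneg b)]) (by omega)
            _ ≤ (Real.exp (64 * quadConst a * b ^ 2)) ^ n :=
                pow_le_pow_left₀ (by positivity)
                  (by linarith [Real.add_one_le_exp (64 * quadConst a * b ^ 2)]) _
            _ = _ := by rw [← Real.exp_nat_mul]; congr 1; ring
      _ = _ := by rw [hp]

/-! ### The parameters for large `n` -/

/-- The properties of the parameters of a single graph that hold for all large `n`. -/
structure Admissible {m : ℕ} (a : Fin (m + 1) → ℝ) (K : Fin (m + 1) → ℕ) (P : ℕ) : Prop where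
  pos : ∀ i, 0 < a i
  sum : ∑ i, a i = 1
  two_le : 2 ≤ K 0
  le : ∀ i, K 0 ≤ K i
  le_last : ∀ i, K i ≤ K (Fin.last m)
  sq_le : K (Fin.last m) ^ 2 ≤ P

namespace Admissible

variable {m : ℕ} {a : Fin (m + 1) → ℝ} {K : Fin (m + 1) → ℕ} {P : ℕ}

lemma pool_pos (h : Admissible a K P) : 0 < P := by
  have := h.two_le; have := h.le (Fin.last m); have := h.sq_le
  nlinarith

lemma mul_le (h : Admissible a K P) (i : Fin (m + 1)) : K 0 * K i ≤ P := by
  have h1 := h.le (Fin.last m); have h2 := h.le_last i; have := h.sq_le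
  have := Nat.mul_le_mul h1 h2
  nlinarith

lemma mul_le_real (h : Admissible a K P) (i : Fin (m + 1)) : (K 0 : ℝ) * K i ≤ P := by
  exact_mod_cast h.mul_le i

lemma le_pool (h : Admissible a K P) (i : Fin (m + 1)) : K i ≤ P := by
  have := h.mul_le i; have := h.two_le
  nlinarith

lemma two_mul_le (h : Admissible a K P) : 2 * K 0 ≤ P := by
  have := h.mul_le 0; have := h.two_le
  nlinarith

end Admissible

lemma eventually_admissible {m : ℕ} {a : Fin (m + 1) → ℝ} (ha_pos : ∀ i, 0 < a i)
    (ha_sum : ∑ i, a i = 1) {K : ℕ → Fin (m + 1) → ℕ} {P : ℕ → ℕ}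
    (hK_first : Tendsto (fun n => K n 0) atTop atTop)
    (hK_mono : ∀ᶠ n in atTop, Monotone (K n))
    (hK_last : (fun n => (K n (Fin.last m) : ℝ)) =o[atTop] fun n => Real.sqrt (P n)) :
    ∀ᶠ n in atTop, Admissible a (K n) (P n) := by
  filter_upwards [hK_first.eventually_ge_atTop 2, hK_mono, hK_last.bound one_pos] with n h1 h2 h3
  refine ⟨ha_pos, ha_sum, h1, fun i => h2 (Fin.zero_le i), fun i => h2 (Fin.le_last i), ?_⟩
  rw [Real.norm_of_nonneg (Nat.cast_nonneg _), Real.norm_of_nonneg (Real.sqrt_nonneg _), one_mul,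
    Real.le_sqrt (Nat.cast_nonneg _) (Nat.cast_nonneg _)] at h3
  exact_mod_cast h3

lemma eventually_edgeProb_eq {m : ℕ} {a : Fin (m + 1) → ℝ} {K : ℕ → Fin (m + 1) → ℕ} {P : ℕ → ℕ}
    (hadm : ∀ᶠ n in atTop, Admissible a (K n) (P n)) {β : ℕ → ℝ}
    (hb : ∀ᶠ n : ℕ in atTop, ∀ x y : Fin n, x ≠ y →
      edgeProb a (K n) (P n) x y 0 = (Real.log n + β n) / n) :
    ∀ᶠ n : ℕ in atTop, (Real.log n + β n) / n = 1 - avoidProb a (K n) (P n) (K n 0) := by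
  filter_upwards [hadm, hb, eventually_ge_atTop 2] with n h1 h2 h3
  have hne : (⟨0, by omega⟩ : Fin n) ≠ ⟨1, by omega⟩ := by simp [Fin.ext_iff]
  rw [← h2 _ _ hne, edgeProb_eq h1.pos h1.sum h1.le_pool hne, avoidProb]
  simp_rw [mul_sub, mul_one, Finset.sum_sub_distrib, h1.sum]

lemma tendsto_log_pow_div (k : ℕ) {s : ℝ} (hs : 0 < s) :
    Tendsto (fun n : ℕ => Real.log n ^ k / (n : ℝ) ^ s) atTop (𝓝 0) := by
  have h : (fun x : ℝ => Real.log x ^ (k : ℝ)) =o[atTop] fun x => x ^ s :=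
    isLittleO_log_rpow_rpow_atTop _ hs
  have h2 := h.tendsto_div_nhds_zero.comp tendsto_natCast_atTop_atTop
  simpa [Function.comp_def] using h2

lemma eventually_abs_le {β : ℕ → ℝ} (hβ : β =o[atTop] fun n : ℕ => Real.log n) {c : ℝ}
    (hc : 0 < c) : ∀ᶠ n : ℕ in atTop, |β n| ≤ c * Real.log n := by
  filter_upwards [hβ.bound hc] with n h
  rwa [Real.norm_eq_abs, Real.norm_of_nonneg (Real.log_natCast_nonneg n)] at h

lemma tendsto_edge_mul_sq {β : ℕ → ℝ} (hβ : β =o[atTop] fun n : ℕ => Real.log n) :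
    Tendsto (fun n : ℕ => (n : ℝ) * ((Real.log n + β n) / n) ^ 2) atTop (𝓝 0) := by
  have h1 : Tendsto (fun n : ℕ => 4 * (Real.log n ^ 2 / (n : ℝ) ^ (1 : ℝ))) atTop (𝓝 0) := by
    simpa using (tendsto_log_pow_div 2 one_pos).const_mul 4
  refine squeeze_zero' (Eventually.of_forall fun n => by positivity) ?_ h1
  filter_upwards [eventually_abs_le hβ one_pos, eventually_gt_atTop 0] with n h2 h3
  have hn : (0 : ℝ) < n := by exact_mod_cast h3
  have hl := Real.log_natCast_nonneg n
  have h4 : (Real.log n + β n) ^ 2 ≤ 4 * Real.log n ^ 2 := by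
    have := abs_le.1 h2
    nlinarith
  rw [Real.rpow_one]
  calc (n : ℝ) * ((Real.log n + β n) / n) ^ 2 = (Real.log n + β n) ^ 2 / n := by field_simp
    _ ≤ 4 * Real.log n ^ 2 / n := by gcongr
    _ = _ := by ring

lemma tendsto_edge {β : ℕ → ℝ} (hβ : β =o[atTop] fun n : ℕ => Real.log n) :
    Tendsto (fun n : ℕ => (Real.log n + β n) / n) atTop (𝓝 0) := by
  have h1 : Tendsto (fun n : ℕ => 2 * (Real.log n ^ 1 / (n : ℝ) ^ (1 : ℝ))) atTop (𝓝 0) := by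
    simpa using (tendsto_log_pow_div 1 one_pos).const_mul 2
  refine squeeze_zero_norm' ?_ h1
  filter_upwards [eventually_abs_le hβ one_pos, eventually_gt_atTop 0] with n h2 h3
  have hn : (0 : ℝ) < n := by exact_mod_cast h3
  have hl := Real.log_natCast_nonneg n
  have h4 : |Real.log n + β n| ≤ 2 * Real.log n := by
    have := abs_le.1 h2
    exact abs_le.2 ⟨by linarith, by linarith⟩
  rw [Real.rpow_one, pow_one, Real.norm_eq_abs, abs_div, abs_of_pos hn, ← mul_div_assoc]
  gcongr

theorem tendsto_probConnected_zero {m : ℕ} {a : Fin (m + 1) → ℝ} {K : ℕ → Fin (m + 1) → ℕ}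
    {P : ℕ → ℕ} (hadm : ∀ᶠ n in atTop, Admissible a (K n) (P n)) {β : ℕ → ℝ}
    (hβ : β =o[atTop] fun n : ℕ => Real.log n)
    (hb : ∀ᶠ n : ℕ in atTop,
      (Real.log n + β n) / n = 1 - avoidProb a (K n) (P n) (K n 0))
    (hlim : Tendsto β atTop atBot) :
    Tendsto (fun n => probConnected n a (K n) (P n)) atTop (𝓝 0) := by
  have h0 := tendsto_edge hβ
  have h2 := tendsto_edge_mul_sq hβ
  have hbd : Tendsto (fun n : ℕ => (a 0)⁻¹ * Real.exp (β n +
      n * ((Real.log n + β n) / n) ^ 2) + ((1 - (Real.log n + β n) / n) ^ 2)⁻¹ *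
      Real.exp (64 * quadConst a * (n * ((Real.log n + β n) / n) ^ 2)) - 1) atTop (𝓝 0) := by
    have e1 : Tendsto (fun n : ℕ => Real.exp (β n + n * ((Real.log n + β n) / n) ^ 2)) atTop
        (𝓝 0) := Real.tendsto_exp_atBot.comp (hlim.atBot_add h2)
    have e2 : Tendsto (fun n : ℕ => Real.exp (64 * quadConst a *
        (n * ((Real.log n + β n) / n) ^ 2))) atTop (𝓝 1) := by
      have := (Real.continuous_exp.tendsto 0).comp
        (by simpa using h2.const_mul (64 * quadConst a))
      simpa [Function.comp_def] using this
    have e3 : Tendsto (fun n : ℕ => ((1 - (Real.log n + β n) / n) ^ 2)⁻¹) atTop (𝓝 1) := by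
      have := ((h0.const_sub 1).pow 2).inv₀ (by norm_num)
      simpa using this
    have := ((e1.const_mul (a 0)⁻¹).add (e3.mul e2)).sub_const 1
    simpa using this
  refine squeeze_zero' (Eventually.of_forall fun n => measureReal_nonneg) ?_ hbd
  filter_upwards [hadm, hb, h0.eventually_le_const (by norm_num : (0 : ℝ) < 1 / 4),
    eventually_ge_atTop 2] with n h3 h4 h5 h6
  have hn : (0 : ℝ) < n := by exact_mod_cast (by omega : 0 < n)
  refine (probConnected_le_exp h6 h3.pos h3.sum h3.le_pool h3.two_mul_le h3.mul_le_real
    (by have := h3.two_le; omega) h4 h5).trans (le_of_eq ?_)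
  congr 4
  field_simp
  ring

/-! ### Disconnected graphs -/

/-- The event that the vertices of `B` are in groups of `D` and share no object with the vertices
of `A`. -/
def separatedEvent {n m P : ℕ} (A B : Finset (Fin n)) (D : Finset (Fin (m + 1))) :
    Set (Fin n → VertexChoice m P) :=
  {ω | (∀ y ∈ B, (ω y).1 ∈ D) ∧ ∀ x ∈ A, ∀ y ∈ B, Disjoint (ω x).2 (ω y).2}

/-- The event that fewer than `s` vertices are in the last group. -/
def lastGroupSparse {n m P : ℕ} (s : ℝ) : Set (Fin n → VertexChoice m P) :=
  {ω | ((Finset.univ.filter fun v => (ω v).1 = Fin.last m).card : ℝ) < s}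

lemma exists_cut_of_not_connected {n m P : ℕ} (hn : 0 < n) {ω : Fin n → VertexChoice m P}
    (h : ¬ (intersectionGraph ω).Connected) :
    ∃ T : Finset (Fin n), 1 ≤ T.card ∧ 2 * T.card ≤ n ∧
      ∀ x ∈ T, ∀ y ∉ T, Disjoint (ω x).2 (ω y).2 := by
  classical
  have : Nonempty (Fin n) := ⟨⟨0, hn⟩⟩
  have hp : ¬ (intersectionGraph ω).Preconnected := fun hp => h ⟨hp⟩
  unfold SimpleGraph.Preconnected at hp
  push Not at hp
  obtain ⟨u, v, huv⟩ := hp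
  set C : Finset (Fin n) := Finset.univ.filter fun x => (intersectionGraph ω).Reachable u x with hC
  have hcut : ∀ x ∈ C, ∀ y ∉ C, Disjoint (ω x).2 (ω y).2 := by
    intro x hx y hy
    by_contra hd
    have hx' : (intersectionGraph ω).Reachable u x := (Finset.mem_filter.1 hx).2
    have hadj : (intersectionGraph ω).Adj x y :=
      ⟨fun e => hy (e ▸ hx), Finset.not_disjoint_iff_nonempty_inter.1 hd⟩
    exact hy (Finset.mem_filter.2 ⟨Finset.mem_univ _, hx'.trans hadj.reachable⟩)
  have huC : u ∈ C := Finset.mem_filter.2 ⟨Finset.mem_univ _, SimpleGraph.Reachable.refl u⟩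
  have hvC : v ∈ Cᶜ := by simp [hC, huv]
  have hcard : C.card + Cᶜ.card = n := by simp
  by_cases h2 : 2 * C.card ≤ n
  · exact ⟨C, Finset.card_pos.2 ⟨u, huC⟩, h2, hcut⟩
  · refine ⟨Cᶜ, Finset.card_pos.2 ⟨v, hvC⟩, by omega, fun x hx y hy => ?_⟩
    exact (hcut y (by simpa using hy) x (by simpa using hx)).symm

/-- A disconnected graph has a small cut, or few vertices in the last group, or a large set of
vertices that shares no object with a large subset of the last group: one side of a balanced cut
contains half of the last group. -/
lemma not_connected_subset {n m P : ℕ} (hn : 0 < n) {c s : ℝ} (hc : c ≤ 1 / 2) :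
    {ω : Fin n → VertexChoice m P | (intersectionGraph ω).Connected}ᶜ ⊆
      (⋃ r ∈ Finset.Icc 1 ⌊c * n⌋₊, ⋃ T ∈ Finset.powersetCard r Finset.univ,
        separatedEvent T Tᶜ Finset.univ) ∪ lastGroupSparse (2 * s) ∪
      ⋃ q ∈ Finset.univ.filter (fun q : Finset (Fin n) × Finset (Fin n) =>
        Disjoint q.1 q.2 ∧ c * n ≤ q.1.card ∧ s ≤ q.2.card),
        separatedEvent q.1 q.2 {Fin.last m} := by
  classical
  intro ω hω
  obtain ⟨T, hT1, hT2, hcut⟩ := exists_cut_of_not_connected hn hω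
  have hcard : T.card + Tᶜ.card = n := by simp
  rcases le_or_gt (T.card : ℝ) (c * n) with hTc | hTc
  · refine Or.inl (Or.inl (Set.mem_biUnion (x := T.card) ?_ (Set.mem_biUnion (x := T) ?_ ?_)))
    · exact Finset.mem_Icc.2 ⟨hT1, Nat.le_floor hTc⟩
    · simp [Finset.mem_powersetCard]
    · exact ⟨fun y _ => Finset.mem_univ _, fun x hx y hy => hcut x hx y (by simpa using hy)⟩
  by_cases hM : ω ∈ lastGroupSparse (2 * s)
  · exact Or.inl (Or.inr hM)
  refine Or.inr ?_
  simp only [lastGroupSparse, Set.mem_ofPred_eq, not_lt] at hM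
  set M := Finset.univ.filter fun v => (ω v).1 = Fin.last m with hM_def
  have hsplit : (M ∩ T).card + (M ∩ Tᶜ).card = M.card := by
    rw [← Finset.card_union_of_disjoint, ← Finset.inter_union_distrib_left, Finset.union_compl,
      Finset.inter_univ]
    exact Finset.disjoint_left.2 fun x hx hx' => by simp_all
  have hsplit' : ((M ∩ T).card : ℝ) + (M ∩ Tᶜ).card = M.card := by exact_mod_cast hsplit
  have hlast : ∀ A : Finset (Fin n), ∀ y ∈ M ∩ A, (ω y).1 ∈ ({Fin.last m} : Finset _) :=
    fun A y hy => by
      rw [Finset.mem_singleton]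
      exact (Finset.mem_filter.1 (Finset.mem_inter.1 hy).1).2
  rcases le_or_gt s ((M ∩ Tᶜ).card : ℝ) with hs | hs
  · refine Set.mem_biUnion (x := (T, M ∩ Tᶜ)) ?_ ⟨hlast Tᶜ, fun x hx y hy => ?_⟩
    · refine Finset.mem_coe.2 (Finset.mem_filter.2 ⟨Finset.mem_univ _, ?_, hTc.le, hs⟩)
      exact disjoint_compl_right.mono_right Finset.inter_subset_right
    · exact hcut x hx y (by simpa using (Finset.mem_inter.1 hy).2)
  · refine Set.mem_biUnion (x := (Tᶜ, M ∩ T)) ?_ ⟨hlast T, fun x hx y hy => ?_⟩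
    · refine Finset.mem_coe.2 (Finset.mem_filter.2 ⟨Finset.mem_univ _, ?_, ?_, by linarith⟩)
      · exact disjoint_compl_left.mono_right Finset.inter_subset_right
      · have h1 : (T.card : ℝ) + Tᶜ.card = n := by exact_mod_cast hcard
        have h2 : 2 * (T.card : ℝ) ≤ n := by exact_mod_cast hT2
        have h3 : (0 : ℝ) ≤ n := Nat.cast_nonneg n
        show c * n ≤ (Tᶜ.card : ℝ)
        nlinarith [mul_le_mul_of_nonneg_right hc h3]
    · exact (hcut y (Finset.mem_inter.1 hy).2 x (by simpa using hx)).symm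

/-- Chernoff's bound for the size of the last group. -/
lemma choicesLaw_lastGroupSparse_le {n m : ℕ} {a : Fin (m + 1) → ℝ} {K : Fin (m + 1) → ℕ} {P : ℕ}
    (h : Admissible a K P) :
    (choicesLaw n a K P).real (lastGroupSparse (a (Fin.last m) / 2 * n)) ≤
      Real.exp (-(a (Fin.last m) / 10 * n)) := by
  classical
  set α := a (Fin.last m) with hα
  have hα0 : 0 < α := h.pos _
  set w := choiceWeight a K P with hw
  let g : VertexChoice m P → ℝ := fun c => if c.1 = Fin.last m then Real.exp (-1) else 1
  have hg0 : ∀ c, 0 < g c := fun c => by simp only [g]; split_ifs <;> positivity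
  rw [choicesLaw_real_eq h.pos h.sum h.le_pool]
  calc _ ≤ ∑ ω : Fin n → VertexChoice m P, (∏ v, w (ω v)) *
        (Real.exp (α / 2 * n) * ∏ v, g (ω v)) := by
        refine Finset.sum_le_sum fun ω _ => mul_le_mul_of_nonneg_left ?_
          (Finset.prod_nonneg fun v _ => choiceWeight_nonneg h.pos K P _)
        have hprod : ∏ v, g (ω v) = Real.exp
            (-((Finset.univ.filter fun v => (ω v).1 = Fin.last m).card : ℝ)) := by
          simp only [g]
          rw [Finset.prod_ite, Finset.prod_const, Finset.prod_const_one, mul_one,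
            ← Real.exp_nat_mul]
          congr 1; ring
        by_cases hω : ω ∈ lastGroupSparse (α / 2 * n)
        · rw [Set.indicator_of_mem hω, hprod, ← Real.exp_add, Real.one_le_exp_iff]
          have : ((Finset.univ.filter fun v => (ω v).1 = Fin.last m).card : ℝ) < α / 2 * n := hω
          linarith
        · rw [Set.indicator_of_notMem hω]
          exact mul_nonneg (Real.exp_pos _).le (Finset.prod_nonneg fun v _ => (hg0 _).le)
    _ = Real.exp (α / 2 * n) * (1 - α * (1 - Real.exp (-1))) ^ n := by
        have h1 := sum_prod_mul_prod (ι := Fin n) w (fun _ c => g c)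
        have h2 : ∑ c, w c * g c = 1 - α * (1 - Real.exp (-1)) := by
          have h3 : ∀ c, w c * g c = w c - (1 - Real.exp (-1)) *
              (w c * if c.1 = Fin.last m then 1 else 0) := fun c => by
            simp only [g]; split_ifs <;> ring
          simp_rw [h3]
          rw [Finset.sum_sub_distrib, ← Finset.mul_sum, sum_choiceWeight_group h.le_pool,
            sum_choiceWeight h.sum h.le_pool]
          ring
        rw [Finset.prod_const, Finset.card_univ, Fintype.card_fin, h2] at h1
        rw [← h1, Finset.mul_sum]
        exact Finset.sum_congr rfl fun ω _ => by ring
    _ ≤ Real.exp (α / 2 * n) * (Real.exp (-(α * (1 - Real.exp (-1))))) ^ n := by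
        have hα1 : α ≤ 1 := by
          rw [← h.sum]
          exact Finset.single_le_sum (fun i _ => (h.pos i).le) (Finset.mem_univ _)
        have he : 0 < Real.exp (-1) := Real.exp_pos _
        gcongr
        · nlinarith
        · exact Real.one_sub_le_exp_neg _
    _ ≤ _ := by
        rw [← Real.exp_nat_mul, ← Real.exp_add]
        refine Real.exp_le_exp.2 ?_
        have he : Real.exp (-1) < 0.4 := Real.exp_neg_one_lt_d9.trans (by norm_num)
        have : 0 ≤ α * n := by positivity
        nlinarith

/-- A set of at least `c n` vertices uses so many objects that it is very unlikely to share
none with `s` given vertices of the last group. -/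
lemma choicesLaw_separated_last_le {n m : ℕ} {a : Fin (m + 1) → ℝ} {K : Fin (m + 1) → ℕ} {P : ℕ}
    (h : Admissible a K P) (hn : 0 < n) {c s : ℝ} (hc : 0 < c) {A B : Finset (Fin n)}
    (hAB : Disjoint A B) (hA : c * n ≤ A.card) (hB : s ≤ B.card) :
    (choicesLaw n a K P).real (separatedEvent A B {Fin.last m}) ≤
      Real.exp (-(2 * c * n * K 0)) +
      Real.exp (-(s * min (c / 2 * (n * overlapMean a K P)) (Real.exp (-6) * K 0))) := by
  have hP := h.pool_pos
  have hP' : (0 : ℝ) < P := by exact_mod_cast hP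
  have hn' : (0 : ℝ) < n := by exact_mod_cast hn
  have hK0 : (0 : ℝ) < K 0 := by exact_mod_cast (by have := h.two_le; omega : 0 < K 0)
  refine (choicesLaw_separated_le h.pos h.sum hP h.le_pool h.le hAB _).trans ?_
  set N := A.card * K 0 with hN
  have hNc : c * n * K 0 ≤ N := by
    rw [hN]; push_cast; gcongr
  have hNpos : 0 < N := by
    have : (0 : ℝ) < N := lt_of_lt_of_le (by positivity) hNc
    exact_mod_cast this
  set u₀ : ℝ := min (c * n * K 0 / 2) (P * Real.exp (-6)) with hu₀
  set κ := K (Fin.last m) with hκ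
  set t : ℝ := min (c / 2 * (n * overlapMean a K P)) (Real.exp (-6) * K 0) with ht
  have hθ := overlapMean_nonneg h.pos K P
  have ht0 : 0 ≤ t := le_min (by positivity) (by positivity)
  have htu : t ≤ u₀ * κ / P := by
    rw [le_div_iff₀ hP', hu₀,
      min_mul_of_nonneg (c * n * K 0 / 2) (P * Real.exp (-6)) (Nat.cast_nonneg _)]
    refine le_min ?_ ?_
    · have h1 : overlapMean a K P * P = K 0 * meanSize a K := by
        rw [overlapMean]; field_simp
      calc t * P ≤ (c / 2 * (n * overlapMean a K P)) * P := by gcongr; exact min_le_left _ _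
        _ = c * n * K 0 / 2 * meanSize a K := by
            rw [show (c / 2 * (n * overlapMean a K P)) * P =
              c / 2 * n * (overlapMean a K P * P) by ring, h1]; ring
        _ ≤ _ := by gcongr; exact meanSize_le h.pos h.sum h.le_last
    · calc t * P ≤ Real.exp (-6) * K 0 * P := by gcongr; exact min_le_right _ _
        _ ≤ Real.exp (-6) * κ * P := by
            gcongr; exact h.le _
        _ = _ := by ring
  calc _ ≤ imageMean N P (fun u => (if (u : ℝ) ≤ u₀ then 1 else 0) + Real.exp (-(s * t))) := by
        refine imageMean_mono fun u _ huP => ?_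
        rw [Finset.sum_singleton]
        have hq0 : 0 ≤ a (Fin.last m) * (((P - u).choose κ : ℝ) / (P.choose κ : ℝ)) :=
          mul_nonneg (h.pos _).le (by positivity)
        have ha1 : a (Fin.last m) ≤ 1 := by
          rw [← h.sum]
          exact Finset.single_le_sum (fun i _ => (h.pos i).le) (Finset.mem_univ _)
        have hq : a (Fin.last m) * (((P - u).choose κ : ℝ) / (P.choose κ : ℝ)) ≤
            Real.exp (-((u : ℝ) * κ / P)) :=
          (mul_le_of_le_one_left (by positivity) ha1).trans (choose_ratio_le_exp huP (h.le_pool _))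
        split_ifs with hu
        · have h1 : (a (Fin.last m) * (((P - u).choose κ : ℝ) / (P.choose κ : ℝ))) ^ B.card ≤ 1 :=
            pow_le_one₀ hq0 (hq.trans (Real.exp_le_one_iff.2 (by
              rw [neg_nonpos]; positivity)))
          have := Real.exp_pos (-(s * t))
          linarith
        · rw [zero_add]
          calc _ ≤ (Real.exp (-t)) ^ B.card := by
                refine pow_le_pow_left₀ hq0 (hq.trans (Real.exp_le_exp.2 (neg_le_neg ?_))) _
                refine htu.trans ?_
                push Not at hu
                gcongr
            _ = Real.exp (-(B.card * t)) := by rw [← Real.exp_nat_mul]; congr 1; ring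
            _ ≤ _ := Real.exp_le_exp.2 (neg_le_neg (by gcongr))
    _ ≤ _ := by
        rw [imageMean_add, imageMean_const hP]
        gcongr
        refine (imageMean_le_tail hP hNpos (ε := 1 / 2) (L := 6) (by norm_num) (by norm_num)
          (min_le_right _ _) ((min_le_left _ _).trans (by linarith))).trans ?_
        refine Real.exp_le_exp.2 ?_
        linarith

/-- The contributions to the probability of being disconnected: small cuts, a small last group, and
balanced cuts. -/
lemma one_sub_probConnected_le {n m : ℕ} {a : Fin (m + 1) → ℝ} {K : Fin (m + 1) → ℕ} {P : ℕ}
    (h : Admissible a K P) (hn : 0 < n) {c : ℝ} (hc : 0 < c) (hc2 : c ≤ 1 / 2) :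
    1 - probConnected n a K P ≤
      (∑ r ∈ Finset.Icc 1 ⌊c * n⌋₊, (n.choose r : ℝ) *
        imageMean (r * K 0) P (fun u => avoidProb a K P u ^ (n - r))) +
      Real.exp (-(a (Fin.last m) / 10 * n)) +
      Real.exp (2 * n) * (Real.exp (-(2 * c * n * K 0)) +
        Real.exp (-(a (Fin.last m) / 4 * n *
          min (c / 2 * (n * overlapMean a K P)) (Real.exp (-6) * K 0)))) := by
  classical
  have := isProbabilityMeasure_vertexLaw h.pos h.sum h.le_pool
  have : IsProbabilityMeasure (choicesLaw n a K P) := by unfold choicesLaw; infer_instance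
  rw [probConnected, ← probReal_compl_eq_one_sub (Set.toFinite _).measurableSet]
  refine (measureReal_mono (not_connected_subset hn (s := a (Fin.last m) / 4 * n) hc2)).trans ?_
  refine (measureReal_union_le _ _).trans (add_le_add ((measureReal_union_le _ _).trans
    (add_le_add ?_ ?_)) ?_)
  · refine (measureReal_biUnion_finset_le _ _).trans (Finset.sum_le_sum fun r _ => ?_)
    refine (measureReal_biUnion_finset_le _ _).trans ?_
    calc _ ≤ ∑ T ∈ Finset.powersetCard r (Finset.univ : Finset (Fin n)),
          imageMean (r * K 0) P (fun u => avoidProb a K P u ^ (n - r)) := by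
          refine Finset.sum_le_sum fun T hT => ?_
          have hTr : T.card = r := (Finset.mem_powersetCard.1 hT).2
          have := choicesLaw_separated_le (n := n) h.pos h.sum h.pool_pos h.le_pool h.le
            (A := T) (B := Tᶜ) disjoint_compl_right Finset.univ
          rw [Finset.card_compl, Fintype.card_fin, hTr] at this
          exact this
      _ = _ := by simp
  · rw [show 2 * (a (Fin.last m) / 4 * n) = a (Fin.last m) / 2 * n by ring]
    exact choicesLaw_lastGroupSparse_le h
  · refine (measureReal_biUnion_finset_le _ _).trans ?_
    refine (Finset.sum_le_card_nsmul _ _ (Real.exp (-(2 * c * n * K 0)) +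
      Real.exp (-(a (Fin.last m) / 4 * n *
        min (c / 2 * (n * overlapMean a K P)) (Real.exp (-6) * K 0)))) fun q hq => ?_).trans ?_
    · obtain ⟨-, h1, h2, h3⟩ := Finset.mem_filter.1 hq
      exact choicesLaw_separated_last_le h hn hc h1 h2 h3
    · rw [nsmul_eq_mul]
      gcongr
      calc _ ≤ ((Fintype.card (Finset (Fin n) × Finset (Fin n)) : ℕ) : ℝ) := by
            exact_mod_cast Finset.card_le_univ _
        _ = (2 : ℝ) ^ (2 * n) := by simp [two_mul, pow_add]
        _ ≤ (Real.exp 1) ^ (2 * n) := by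
            gcongr
            exact (by norm_num : (2 : ℝ) ≤ 2.7182818283).trans Real.exp_one_gt_d9.le
        _ = _ := by rw [← Real.exp_nat_mul]; congr 1; push_cast; ring

/-! ### Small cuts -/

lemma avoidProb_pow_le {m : ℕ} {a : Fin (m + 1) → ℝ} {K : Fin (m + 1) → ℕ} {P : ℕ}
    (h : Admissible a K P) {v : ℝ} (hv : 0 ≤ v) {u : ℕ} (hu : u ≤ P) (hvu : v ≤ u) {y : ℝ}
    (hy : y = v * meanSize a K / P) (k : ℕ) :
    avoidProb a K P u ^ k ≤ Real.exp (-(k * (y - quadConst a * y ^ 2))) := by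
  calc avoidProb a K P u ^ k ≤ (Real.exp (-(y - quadConst a * y ^ 2))) ^ k := by
        refine pow_le_pow_left₀ (avoidProb_nonneg h.pos K P u) ?_ k
        refine (avoidProb_le_expAvoid h.pos h.le_pool hu).trans
          ((expAvoid_anti h.pos K P hvu).trans ((expAvoid_le h.pos h.sum K P hv hy).trans ?_))
        have := Real.one_sub_le_exp_neg (y - quadConst a * y ^ 2)
        linarith
    _ = _ := by rw [← Real.exp_nat_mul]; congr 1; ring

/-- The expected number of cuts of very small size `r`: up to a constant, it is the value
`n ^ r * exp (-r n θ)` that it would have without overlaps among the object sets of the `r`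
vertices. -/
lemma choose_mul_imageMean_le_of_small {n m : ℕ} {a : Fin (m + 1) → ℝ} {K : Fin (m + 1) → ℕ}
    {P : ℕ} (h : Admissible a K P) (hn : 0 < n) {r : ℕ} (hr : r ≤ n) {θ : ℝ}
    (hθ : θ = overlapMean a K P)
    (herr : r ^ 2 * θ * (1 + Real.exp (n * θ / K 0)) + quadConst a * n * (r * θ) ^ 2 ≤ 1) :
    (n.choose r : ℝ) * imageMean (r * K 0) P (fun u => avoidProb a K P u ^ (n - r)) ≤
      Real.exp (1 + r * (Real.log n - n * θ)) := by
  have hP := h.pool_pos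
  have hP' : (0 : ℝ) < P := by exact_mod_cast hP
  have hn' : (0 : ℝ) < n := by exact_mod_cast hn
  have hr' : (r : ℝ) ≤ n := by exact_mod_cast hr
  have hK0 : (0 : ℝ) < K 0 := by exact_mod_cast (by have := h.two_le; omega : 0 < K 0)
  have hθ0 : 0 ≤ θ := hθ ▸ overlapMean_nonneg h.pos K P
  have hC := quadConst_pos h.pos
  set N := r * K 0 with hN
  set z := Real.exp (n * θ / K 0) with hz
  have hz1 : 1 ≤ z := Real.one_le_exp (by positivity)
  have hpt : ∀ u ≤ N, u ≤ P → avoidProb a K P u ^ (n - r) ≤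
      Real.exp (-(r * (n * θ)) + r ^ 2 * θ + quadConst a * n * (r * θ) ^ 2) * z ^ (N - u) := by
    intro u huN huP
    set y : ℝ := u * meanSize a K / P with hy
    have hyθ : y = u * θ / K 0 := by
      rw [hy, hθ, overlapMean]; field_simp
    have huN' : (u : ℝ) ≤ r * K 0 := by exact_mod_cast huN
    have hy0 : 0 ≤ y := by rw [hyθ]; positivity
    have hyr : y ≤ r * θ := by
      rw [hyθ, div_le_iff₀ hK0]
      nlinarith [mul_le_mul_of_nonneg_right huN' hθ0]
    refine (avoidProb_pow_le h (Nat.cast_nonneg u) huP le_rfl hy (n - r)).trans ?_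
    rw [hz, ← Real.exp_nat_mul, ← Real.exp_add, Nat.cast_sub hr, Nat.cast_sub huN, hN]
    refine Real.exp_le_exp.2 ?_
    have h1 : ((r * K 0 : ℕ) - (u : ℝ)) * (n * θ / K 0) = r * (n * θ) - n * y := by
      rw [hyθ]; push_cast; field_simp
    rw [h1]
    have h2 : (r : ℝ) * y ≤ r ^ 2 * θ := by
      nlinarith [mul_le_mul_of_nonneg_left hyr (Nat.cast_nonneg (α := ℝ) r)]
    have h3 : ((n : ℝ) - r) * (quadConst a * y ^ 2) ≤ quadConst a * n * (r * θ) ^ 2 := by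
      have : y ^ 2 ≤ (r * θ) ^ 2 := pow_le_pow_left₀ hy0 hyr 2
      calc ((n : ℝ) - r) * (quadConst a * y ^ 2) ≤ n * (quadConst a * (r * θ) ^ 2) := by
            gcongr
            linarith [Nat.cast_nonneg (α := ℝ) r]
        _ = _ := by ring
    nlinarith
  have hNP : z * (N : ℝ) ^ 2 / P ≤ r ^ 2 * θ * z := by
    rw [div_le_iff₀ hP', hθ, overlapMean, hN]
    have h4 := le_meanSize h.pos h.sum h.le
    push_cast
    calc z * (r * K 0 : ℝ) ^ 2 = r ^ 2 * z * (K 0 * K 0) := by ring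
      _ ≤ r ^ 2 * z * (K 0 * meanSize a K) := by gcongr
      _ = _ := by field_simp
  have hch : (n.choose r : ℝ) ≤ Real.exp (r * Real.log n) := by
    rw [Real.exp_nat_mul, Real.exp_log hn']
    exact_mod_cast Nat.choose_le_pow n r
  calc _ ≤ Real.exp (r * Real.log n) * (Real.exp (-(r * (n * θ)) + r ^ 2 * θ +
        quadConst a * n * (r * θ) ^ 2) * Real.exp (r ^ 2 * θ * z)) := by
        refine mul_le_mul hch ?_ ?_ (by positivity)
        · refine (imageMean_mono hpt).trans ?_
          rw [imageMean_const_mul]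
          gcongr
          exact (imageMean_pow_le hP hz1).trans (Real.exp_le_exp.2 hNP)
        · exact div_nonneg (Finset.sum_nonneg fun f _ =>
            pow_nonneg (avoidProb_nonneg h.pos K P _) _) (by positivity)
    _ ≤ _ := by
        rw [← Real.exp_add, ← Real.exp_add]
        exact Real.exp_le_exp.2 (by nlinarith)

lemma choose_le_exp_log {n r : ℕ} (hn : 0 < n) (hr : 0 < r) {s : ℝ}
    (hs : Real.log (n / r) ≤ s) : (n.choose r : ℝ) ≤ Real.exp (r * (1 + s)) := by
  have hn' : (0 : ℝ) < n := by exact_mod_cast hn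
  have hr' : (0 : ℝ) < r := by exact_mod_cast hr
  refine (choose_le_exp hr).trans ?_
  rw [mul_add, mul_one, Real.exp_add]
  gcongr
  rw [← Real.exp_log (show (0 : ℝ) < n / r by positivity), ← Real.exp_nat_mul]
  exact Real.exp_le_exp.2 (by gcongr)

/-- The expected number of cuts of moderate size `r`, between `n ^ (1 / 3)` and a small multiple of
`n`. The three terms come from the event that the `r` vertices use unusually few objects, and,
outside this event, from the cases where the mean `r θ` is below and above the constant `η`. -/
lemma choose_mul_imageMean_le_of_moderate {n m : ℕ} {a : Fin (m + 1) → ℝ} {K : Fin (m + 1) → ℕ}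
    {P : ℕ} (h : Admissible a K P) {r : ℕ} (hr : 0 < r) {θ η c d : ℝ}
    (hθ : θ = overlapMean a K P) (hη0 : 0 < η) (hη1 : η ≤ 1) (hη : quadConst a * η ≤ 1 / 16)
    (hc : c ≤ 1 / 16) (hcη : c * Real.log (η / 4)⁻¹ ≤ η / 4) (hrc : (r : ℝ) ≤ c * n)
    (hd : 0 < d) (hnP : (n : ℝ) ≤ d * P)
    (hlogr : Real.log (n / r) ≤ 2 / 3 * Real.log n) (hlogn : 24 ≤ Real.log n)
    (hnθ : 19 / 20 * Real.log n ≤ n * θ)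
    (hK : 128 ≤ Real.log (K 0)) (hdK : Real.log d + 2 ≤ K 0) :
    (n.choose r : ℝ) * imageMean (r * K 0) P (fun u => avoidProb a K P u ^ (n - r)) ≤
      Real.exp (-r) + Real.exp (-r) + Real.exp (-(η / 4 * n)) := by
  have hP := h.pool_pos
  have hP' : (0 : ℝ) < P := by exact_mod_cast hP
  have hr' : (0 : ℝ) < r := by exact_mod_cast hr
  have hn' : (0 : ℝ) < n := by
    by_contra hneg
    have : (n : ℝ) = 0 := le_antisymm (not_lt.1 hneg) (Nat.cast_nonneg n)
    rw [this, mul_zero] at hrc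
    linarith
  have hn : 0 < n := by exact_mod_cast hn'
  have hrn : r ≤ n := by
    have : (r : ℝ) ≤ n := by nlinarith
    exact_mod_cast this
  have hK0 : (0 : ℝ) < K 0 := by exact_mod_cast (by have := h.two_le; omega : 0 < K 0)
  have hC := quadConst_pos h.pos
  set S := meanSize a K with hS
  have hKS : (K 0 : ℝ) ≤ S := le_meanSize h.pos h.sum h.le
  have hS0 : 0 < S := hK0.trans_le hKS
  set N := r * K 0 with hN
  have hNr : (N : ℝ) = r * K 0 := by rw [hN]; push_cast; rfl
  have hN0 : (0 : ℝ) < N := by rw [hNr]; positivity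
  set x : ℝ := min (N / P) (η / S) with hx
  have hx0 : 0 < x := lt_min (by positivity) (by positivity)
  set L : ℝ := -Real.log x with hL
  have hxL : Real.exp (-L) = x := by rw [hL, neg_neg, Real.exp_log hx0]
  have hLK : Real.log (K 0) ≤ L := by
    rw [hL, le_neg, ← Real.log_inv]
    refine Real.log_le_log hx0 ((min_le_right _ _).trans ?_)
    calc η / S ≤ 1 / K 0 := by gcongr
      _ = _ := one_div _
  have hL128 : 128 ≤ L := hK.trans hLK
  set u₀ : ℝ := min (15 / 16 * N) (η * P / S) with hu₀
  have hu₀0 : 0 ≤ u₀ := le_min (by positivity) (by positivity)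
  have hu₀x : u₀ ≤ P * Real.exp (-L) := by
    rw [hxL, hx, mul_min_of_nonneg _ _ hP'.le]
    refine min_le_min ?_ (le_of_eq (by ring))
    rw [mul_div_cancel₀ _ hP'.ne']
    linarith
  set y : ℝ := u₀ * S / P with hy
  have hyθ : y = min (15 / 16 * (r * θ)) η := by
    rw [hy, hu₀, min_mul_of_nonneg _ _ hS0.le, ← min_div_div_right hP'.le, hNr, hθ, overlapMean]
    congr 1
    · ring
    · field_simp
  have hθ0 : 0 ≤ θ := hθ ▸ overlapMean_nonneg h.pos K P
  have hy0 : 0 ≤ y := by rw [hy]; positivity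
  have hyη : y ≤ η := hyθ ▸ min_le_right _ _
  have hrate : 225 / 256 * (n * y) ≤ ((n - r : ℕ) : ℝ) * (y - quadConst a * y ^ 2) := by
    have h1 : 15 / 16 * y ≤ y - quadConst a * y ^ 2 := by
      have : quadConst a * y * y ≤ 1 / 16 * y := by
        gcongr
        exact (mul_le_mul_of_nonneg_left hyη hC.le).trans hη
      nlinarith
    have h2 : 15 / 16 * (n : ℝ) ≤ ((n - r : ℕ) : ℝ) := by
      rw [Nat.cast_sub hrn]; nlinarith
    calc 225 / 256 * (n * y) = (15 / 16 * n) * (15 / 16 * y) := by ring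
      _ ≤ _ := mul_le_mul h2 h1 (by positivity) (by positivity)
  have himage : imageMean N P (fun u => avoidProb a K P u ^ (n - r)) ≤
      Real.exp (N * (1 - 1 / 16 * L)) +
        (Real.exp (-(225 / 256 * (n * (15 / 16 * (r * θ))))) +
          Real.exp (-(225 / 256 * (n * η)))) := by
    have hmin : Real.exp (-(225 / 256 * (n * y))) ≤
        Real.exp (-(225 / 256 * (n * (15 / 16 * (r * θ))))) +
          Real.exp (-(225 / 256 * (n * η))) := by
      rw [hyθ]
      rcases min_choice (15 / 16 * (r * θ)) η with he | he <;> rw [he]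
      · linarith [Real.exp_pos (-(225 / 256 * (n * η)))]
      · linarith [Real.exp_pos (-(225 / 256 * (n * (15 / 16 * (r * θ)))))]
    refine le_trans (imageMean_mono (ψ := fun u => (if (u : ℝ) ≤ u₀ then 1 else 0) +
      Real.exp (-(225 / 256 * (n * y)))) fun u _ huP => ?_) ?_
    · split_ifs with hu
      · have h1 : avoidProb a K P u ^ (n - r) ≤ 1 := pow_le_one₀ (avoidProb_nonneg h.pos K P u)
          ((avoidProb_le_expAvoid h.pos h.le_pool huP).trans
            (expAvoid_le_one h.pos h.sum K P (Nat.cast_nonneg u)))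
        linarith [Real.exp_pos (-(225 / 256 * (n * y)))]
      · rw [zero_add]
        push Not at hu
        exact (avoidProb_pow_le h hu₀0 huP hu.le hy (n - r)).trans
          (Real.exp_le_exp.2 (neg_le_neg hrate))
    · rw [imageMean_add, imageMean_const hP]
      refine add_le_add (imageMean_le_tail hP (by exact_mod_cast hN0) (by norm_num) (by linarith)
        hu₀x ((min_le_left _ _).trans (by linarith))) hmin
  have hch0 : (0 : ℝ) ≤ n.choose r := Nat.cast_nonneg _
  refine (mul_le_mul_of_nonneg_left himage hch0).trans ?_
  rw [mul_add, mul_add, ← add_assoc]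
  gcongr
  · -- few objects: here `n / r ≤ d * K 0 * exp L`
    have hlog : Real.log (n / r) ≤ Real.log d + Real.log (K 0) + L := by
      have h1 : (n : ℝ) / r ≤ d * K 0 * Real.exp L := by
        rw [div_le_iff₀ hr']
        have h2 : Real.exp L * x = 1 := by rw [← hxL, ← Real.exp_add, add_neg_cancel, Real.exp_zero]
        have h3 : x * P ≤ r * K 0 := by
          rw [← hNr, ← le_div_iff₀ hP']; exact min_le_left _ _
        calc (n : ℝ) ≤ d * P * 1 := by linarith
          _ = d * Real.exp L * (x * P) := by rw [← h2]; ring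
          _ ≤ d * Real.exp L * (r * K 0) := by gcongr
          _ = _ := by ring
      refine (Real.log_le_log (by positivity) h1).trans (le_of_eq ?_)
      rw [Real.log_mul (by positivity) (Real.exp_pos _).ne', Real.log_mul hd.ne' hK0.ne',
        Real.log_exp]
    refine (mul_le_mul_of_nonneg_right (choose_le_exp_log hn hr hlog) (Real.exp_pos _).le).trans ?_
    rw [← Real.exp_add]
    refine Real.exp_le_exp.2 ?_
    rw [hNr]
    have hlK : Real.log (K 0) ≤ K 0 := (Real.log_le_sub_one_of_pos hK0).trans (by linarith)
    have hK128 : (128 : ℝ) ≤ K 0 := hK.trans hlK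
    have h4 : 1 + (Real.log d + Real.log (K 0) + L) + K 0 * (1 - 1 / 16 * L) ≤ -1 := by
      have h6 := mul_le_mul_of_nonneg_left hL128 hK0.le
      have h7 := mul_le_mul_of_nonneg_right hK128 (by linarith : (0 : ℝ) ≤ L)
      linarith
    calc _ = r * (1 + (Real.log d + Real.log (K 0) + L) + K 0 * (1 - 1 / 16 * L)) := by ring
      _ ≤ r * (-1) := by gcongr
      _ = _ := by ring
  · refine (mul_le_mul_of_nonneg_right (choose_le_exp_log hn hr hlogr) (Real.exp_pos _).le).trans ?_
    rw [← Real.exp_add]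
    refine Real.exp_le_exp.2 ?_
    calc _ = r * (1 + 2 / 3 * Real.log n - 3375 / 4096 * (n * θ)) := by ring
      _ ≤ r * (-1) := by gcongr; linarith
      _ = _ := by ring
  · have h5 := choose_le_exp_mul (n := n) (r := r) (x := η / 4) (c := c) (by positivity)
      (by linarith) hrc
    refine (mul_le_mul_of_nonneg_right h5 (Real.exp_pos _).le).trans ?_
    rw [← Real.exp_add]
    refine Real.exp_le_exp.2 ?_
    have h6 := mul_le_mul_of_nonneg_left hcη hn'.le
    have h7 := mul_pos hn' hη0
    linarith

/-! ### The limit of the probability of being connected -/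

/-- The error exponent of `choose_mul_imageMean_le_of_small`, in terms of `t = n ^ (1 / 12)`, for
cuts of size at most `n ^ (1 / 3)`. -/
lemma small_cut_error_le {n r k t ℓ θ C : ℝ} (ht : 1 ≤ t) (hn : n = t ^ 12)
    (hℓ : ℓ = 12 * Real.log t) (hr0 : 0 ≤ r) (hr : r ≤ t ^ 4) (hk : 48 ≤ k) (hθ0 : 0 ≤ θ)
    (hθ : n * θ ≤ 4 * ℓ) (hC : 0 ≤ C) (h1 : 8 * (ℓ / t ^ 3) ≤ 1 / 2)
    (h2 : 16 * C * (ℓ ^ 2 / t ^ 4) ≤ 1 / 2) :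
    r ^ 2 * θ * (1 + Real.exp (n * θ / k)) + C * n * (r * θ) ^ 2 ≤ 1 := by
  have ht0 : 0 < t := by linarith
  have hℓ0 : 0 ≤ ℓ := hℓ ▸ mul_nonneg (by norm_num) (Real.log_nonneg ht)
  have hz : Real.exp (n * θ / k) ≤ t := by
    rw [← Real.le_log_iff_exp_le ht0]
    calc n * θ / k ≤ 4 * ℓ / 48 := by gcongr
      _ = Real.log t := by rw [hℓ]; ring
  have hθ' : θ ≤ 4 * ℓ / t ^ 12 := by
    rw [le_div_iff₀ (by positivity), ← hn]; linarith
  have e1 : r ^ 2 * θ * (1 + Real.exp (n * θ / k)) ≤ 8 * (ℓ / t ^ 3) := by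
    calc _ ≤ (t ^ 4) ^ 2 * (4 * ℓ / t ^ 12) * (t + t) := by gcongr
      _ = _ := by field_simp; ring
  have e2 : C * n * (r * θ) ^ 2 ≤ 16 * C * (ℓ ^ 2 / t ^ 4) := by
    calc _ ≤ C * t ^ 12 * (t ^ 4 * (4 * ℓ / t ^ 12)) ^ 2 := by rw [hn]; gcongr
      _ = _ := by field_simp; ring
  linarith

lemma sum_exp_le {β : ℝ} (hβ : 1 ≤ β) (R : ℕ) :
    ∑ r ∈ Finset.Icc 1 R, Real.exp (1 + r * (-β)) ≤ 2 * Real.exp (1 - β) := by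
  set q := Real.exp (-β) with hq
  have hq0 : 0 < q := Real.exp_pos _
  have hq2 : q ≤ 1 / 2 := by
    have h1 : q ≤ Real.exp (-1) := Real.exp_le_exp.2 (by linarith)
    have h2 : Real.exp (-1) < 0.5 := Real.exp_neg_one_lt_d9.trans (by norm_num)
    linarith
  have h : ∀ k : ℕ, ∑ r ∈ Finset.Icc 1 k, Real.exp (1 + r * (-β)) ≤
      2 * Real.exp (1 - β) - Real.exp 1 * q ^ (k + 1) * 2 := by
    intro k
    induction k with
    | zero => simp [hq, sub_eq_add_neg, Real.exp_add]; linarith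
    | succ k ih =>
      rw [Finset.sum_Icc_succ_top (by omega), Real.exp_add, Real.exp_nat_mul, ← hq]
      have h3 : 0 ≤ Real.exp 1 * q ^ (k + 1) := by positivity
      have h4 : Real.exp 1 * q ^ (k + 1 + 1) = Real.exp 1 * q ^ (k + 1) * q := by ring
      rw [h4]
      nlinarith
  have : 0 ≤ Real.exp 1 * q ^ (R + 1) * 2 := by positivity
  linarith [h R]

lemma tendsto_log_pow_div_pow (k j : ℕ) (hj : 0 < j) :
    Tendsto (fun x : ℝ => Real.log x ^ k / x ^ j) atTop (𝓝 0) := by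
  have h : (fun x : ℝ => Real.log x ^ (k : ℝ)) =o[atTop] fun x => x ^ (j : ℝ) :=
    isLittleO_log_rpow_rpow_atTop _ (by exact_mod_cast hj)
  simpa using h.tendsto_div_nhds_zero

/-- The error terms for a single graph. The numbers `d`, `η` and `c` do not depend on `n`, and
`t` stands for `n ^ (1 / 12)`. -/
lemma one_sub_probConnected_le_error {n m : ℕ} {a : Fin (m + 1) → ℝ} {K : Fin (m + 1) → ℕ} {P : ℕ}
    (h : Admissible a K P) (hn : 0 < n) {d η c t β α : ℝ} (hα : α = a (Fin.last m))
    (hbn : (Real.log n + β) / n = 1 - avoidProb a K P (K 0)) (hd : 0 < d) (hnP : (n : ℝ) ≤ d * P)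
    (hη0 : 0 < η) (hη1 : η ≤ 1) (hηC : quadConst a * η ≤ 1 / 16) (hc0 : 0 < c)
    (hc16 : c ≤ 1 / 16) (hcη : c * Real.log (η / 4)⁻¹ ≤ η / 4)
    (hβn : |β| ≤ 1 / 20 * Real.log n) (hβ1 : 1 ≤ β) (hℓ24 : 24 ≤ Real.log n)
    (hK128 : 128 ≤ Real.log (K 0)) (hKd : Real.log d + 2 ≤ K 0) (hK48 : 48 ≤ (K 0 : ℝ))
    (ht1 : 1 ≤ t) (ht12 : (n : ℝ) = t ^ 12) (hlogt : Real.log n = 12 * Real.log t)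
    (he1 : 8 * (Real.log n / t ^ 3) ≤ 1 / 2)
    (he2 : 16 * quadConst a * (Real.log n ^ 2 / t ^ 4) ≤ 1 / 2)
    (hKc : 3 / (2 * c) ≤ K 0) (hKα : 12 / α / Real.exp (-6) ≤ K 0)
    (hℓα : 12 / α * (20 / 19) / (c / 2) ≤ Real.log n) :
    1 - probConnected n a K P ≤ 2 * Real.exp (1 - β) +
      n * (Real.exp (-(t ^ 4)) + Real.exp (-(t ^ 4)) + Real.exp (-(η / 4 * n))) +
      Real.exp (-(α / 10 * n)) + 2 * Real.exp (-(1 * n)) := by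
  have hC := quadConst_pos h.pos
  have hα0 : 0 < α := hα ▸ h.pos _
  have hn' : (0 : ℝ) < n := by exact_mod_cast hn
  set θ := overlapMean a K P with hθ
  have hbθ := one_sub_avoidProb_le h.pos h.sum h.le_pool (by have := h.two_le; omega)
  have hθb := overlapMean_le h.pos h.sum h.le_pool h.mul_le_real
  rw [← hbn, ← hθ] at hbθ hθb
  rw [div_le_iff₀ hn'] at hbθ
  have hβ' := (abs_le.1 hβn).2
  have hnθ : 19 / 20 * Real.log n ≤ n * θ := by linarith
  have hnθ4 : n * θ ≤ 4 * Real.log n := by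
    have : n * θ ≤ 2 * (Real.log n + β) := by
      calc n * θ ≤ n * (2 * ((Real.log n + β) / n)) := by gcongr
        _ = _ := by field_simp
    linarith
  have hθ0 : 0 ≤ θ := overlapMean_nonneg h.pos _ _
  have hterm : ∀ r ∈ Finset.Icc 1 ⌊c * n⌋₊, (n.choose r : ℝ) *
      imageMean (r * K 0) P (fun u => avoidProb a K P u ^ (n - r)) ≤
      Real.exp (1 + r * (-β)) +
        (Real.exp (-(t ^ 4)) + Real.exp (-(t ^ 4)) + Real.exp (-(η / 4 * n))) := by
    intro r hr
    obtain ⟨hr1, hr2⟩ := Finset.mem_Icc.1 hr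
    have hrc : (r : ℝ) ≤ c * n := (Nat.le_floor_iff (by positivity)).1 hr2
    have hr0 : (0 : ℝ) < r := by exact_mod_cast hr1
    have hrn : r ≤ n := by
      have : (r : ℝ) ≤ n := hrc.trans (mul_le_of_le_one_left hn'.le (by linarith))
      exact_mod_cast this
    rcases le_or_gt (r : ℝ) (t ^ 4) with hrt | hrt
    · have := choose_mul_imageMean_le_of_small h hn hrn hθ (small_cut_error_le ht1 ht12
        hlogt hr0.le hrt hK48 hθ0 hnθ4 hC.le he1 he2)
      refine this.trans ?_
      have h1 : Real.exp (1 + r * (Real.log n - n * θ)) ≤ Real.exp (1 + r * (-β)) :=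
        Real.exp_le_exp.2 (by gcongr; linarith)
      have h2 := Real.exp_pos (-(t ^ 4))
      have h3 := Real.exp_pos (-(η / 4 * n))
      linarith
    · have hlogr : Real.log (n / r) ≤ 2 / 3 * Real.log n := by
        have h1 : (n : ℝ) / r ≤ t ^ 8 := by
          rw [div_le_iff₀ hr0, ht12]
          calc t ^ 12 = t ^ 8 * t ^ 4 := by ring
            _ ≤ _ := by gcongr
        refine (Real.log_le_log (by positivity) h1).trans (le_of_eq ?_)
        rw [Real.log_pow, hlogt]; push_cast; ring
      refine (choose_mul_imageMean_le_of_moderate h hr1 hθ hη0 hη1 hηC hc16 hcη hrc hd hnP hlogr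
        hℓ24 hnθ hK128 hKd).trans ?_
      have h1 : Real.exp (-(r : ℝ)) ≤ Real.exp (-(t ^ 4)) :=
        Real.exp_le_exp.2 (by linarith)
      linarith [Real.exp_pos (1 + r * (-β))]
  have hsum := (Finset.sum_le_sum hterm)
  rw [Finset.sum_add_distrib, Finset.sum_const, nsmul_eq_mul, Nat.card_Icc,
    Nat.add_sub_cancel] at hsum
  have hfloor : (⌊c * n⌋₊ : ℝ) ≤ n := (Nat.floor_le (by positivity)).trans
    (mul_le_of_le_one_left hn'.le (by linarith))
  have hsum1 := sum_exp_le hβ1 ⌊c * n⌋₊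
  have hsum2 : (⌊c * n⌋₊ : ℝ) * (Real.exp (-(t ^ 4)) + Real.exp (-(t ^ 4)) +
      Real.exp (-(η / 4 * n))) ≤ n * (Real.exp (-(t ^ 4)) + Real.exp (-(t ^ 4)) +
      Real.exp (-(η / 4 * n))) := by gcongr
  have hbig : Real.exp (2 * n) * (Real.exp (-(2 * c * n * K 0)) +
      Real.exp (-(α / 4 * n *
        min (c / 2 * (n * θ)) (Real.exp (-6) * K 0)))) ≤ 2 * Real.exp (-(1 * n)) := by
    rw [mul_add, ← Real.exp_add, ← Real.exp_add, two_mul (Real.exp _)]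
    -- both exponents have to exceed `3 n`, to beat the number `exp (2 n)` of pairs
    have hmin : 12 / α ≤ min (c / 2 * (n * θ)) (Real.exp (-6) * K 0) := by
      refine le_min ?_ ?_
      · rw [div_le_iff₀ (by positivity)] at hℓα
        have h5 := mul_le_mul_of_nonneg_left hnθ (by positivity : 0 ≤ c / 2)
        linarith
      · rw [div_le_iff₀ (Real.exp_pos _)] at hKα
        linarith
    refine add_le_add (Real.exp_le_exp.2 ?_) (Real.exp_le_exp.2 ?_)
    · rw [div_le_iff₀ (by positivity)] at hKc
      have h5 := mul_le_mul_of_nonneg_left hKc hn'.le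
      linarith
    · have h3 : α / 4 * n * (12 / α) ≤
          α / 4 * n * min (c / 2 * (n * θ)) (Real.exp (-6) * K 0) := by gcongr
      have h4 : α / 4 * n * (12 / α) = 3 * n := by field_simp; norm_num
      rw [h4] at h3
      linarith
  have hfin := one_sub_probConnected_le h hn hc0 (by linarith)
  rw [← hα, ← hθ] at hfin
  linarith

theorem tendsto_probConnected_one {m : ℕ} {a : Fin (m + 1) → ℝ} (ha : ∀ i, 0 < a i)
    {K : ℕ → Fin (m + 1) → ℕ} {P : ℕ → ℕ} (hadm : ∀ᶠ n in atTop, Admissible a (K n) (P n))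
    (hP : (fun n : ℕ => (n : ℝ)) =O[atTop] fun n => (P n : ℝ))
    (hK_first : Tendsto (fun n => K n 0) atTop atTop) {β : ℕ → ℝ}
    (hβ : β =o[atTop] fun n : ℕ => Real.log n)
    (hb : ∀ᶠ n : ℕ in atTop,
      (Real.log n + β n) / n = 1 - avoidProb a (K n) (P n) (K n 0))
    (hlim : Tendsto β atTop atTop) :
    Tendsto (fun n => probConnected n a (K n) (P n)) atTop (𝓝 1) := by
  obtain ⟨d, hd, hdP⟩ := hP.exists_pos
  have hC := quadConst_pos ha
  set α := a (Fin.last m) with hα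
  have hα0 : 0 < α := ha _
  set η : ℝ := min 1 (1 / (16 * quadConst a)) with hη
  have hη0 : 0 < η := lt_min one_pos (by positivity)
  have hη1 : η ≤ 1 := min_le_left _ _
  have hηC : quadConst a * η ≤ 1 / 16 := by
    calc quadConst a * η ≤ quadConst a * (1 / (16 * quadConst a)) := by
          gcongr; exact min_le_right _ _
      _ = 1 / 16 := by field_simp
  set l := Real.log (η / 4)⁻¹ with hl
  have hl0 : 0 ≤ l := Real.log_nonneg ((one_le_inv₀ (by positivity)).2 (by linarith))
  set c : ℝ := η / 4 / (l + 4) with hc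
  have hc0 : 0 < c := by positivity
  have hc16 : c ≤ 1 / 16 := by
    rw [hc, div_le_iff₀ (by positivity)]; linarith
  have hcη : c * l ≤ η / 4 := by
    rw [hc, div_mul_eq_mul_div, div_le_iff₀ (by positivity)]; nlinarith
  let t : ℕ → ℝ := fun n => (n : ℝ) ^ (1 / 12 : ℝ)
  have ht : Tendsto t atTop atTop :=
    (tendsto_rpow_atTop (by norm_num)).comp tendsto_natCast_atTop_atTop
  have hlogn : Tendsto (fun n : ℕ => Real.log n) atTop atTop :=
    Real.tendsto_log_atTop.comp tendsto_natCast_atTop_atTop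
  have hKreal : Tendsto (fun n => (K n 0 : ℝ)) atTop atTop :=
    tendsto_natCast_atTop_atTop.comp hK_first
  have hKlog : Tendsto (fun n => Real.log (K n 0)) atTop atTop :=
    Real.tendsto_log_atTop.comp hKreal
  have herr1 : Tendsto (fun n => 96 * (Real.log (t n) ^ 1 / t n ^ 3)) atTop (𝓝 0) := by
    simpa using ((tendsto_log_pow_div_pow 1 3 (by norm_num)).comp ht).const_mul 96
  have herr2 : Tendsto (fun n => 16 * quadConst a * 144 * (Real.log (t n) ^ 2 / t n ^ 4)) atTop
      (𝓝 0) := by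
    simpa using ((tendsto_log_pow_div_pow 2 4 (by norm_num)).comp ht).const_mul
      (16 * quadConst a * 144)
  set err : ℕ → ℝ := fun n => 2 * Real.exp (1 - β n) +
    n * (Real.exp (-(t n ^ 4)) + Real.exp (-(t n ^ 4)) + Real.exp (-(η / 4 * n))) +
    Real.exp (-(α / 10 * n)) + 2 * Real.exp (-(1 * n)) with herr
  have hexp : ∀ κ : ℝ, 0 < κ → Tendsto (fun n : ℕ => Real.exp (-(κ * n))) atTop (𝓝 0) :=
    fun κ hκ => Real.tendsto_exp_atBot.comp (tendsto_neg_atTop_atBot.comp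
      (tendsto_natCast_atTop_atTop.const_mul_atTop hκ))
  have ht12 : ∀ n : ℕ, (n : ℝ) = t n ^ 12 := fun n => by
    show (n : ℝ) = ((n : ℝ) ^ (1 / 12 : ℝ)) ^ 12
    rw [← Real.rpow_natCast, ← Real.rpow_mul (Nat.cast_nonneg n)]
    norm_num
  have herr0 : Tendsto err atTop (𝓝 0) := by
    have e1 : Tendsto (fun n => Real.exp (1 - β n)) atTop (𝓝 0) :=
      Real.tendsto_exp_atBot.comp (tendsto_atBot_add_const_left _ 1
        (tendsto_neg_atTop_atBot.comp hlim))
    have e2 : Tendsto (fun n : ℕ => (n : ℝ) * Real.exp (-(t n ^ 4))) atTop (𝓝 0) := by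
      have := (Real.tendsto_pow_mul_exp_neg_atTop_nhds_zero 3).comp
        ((tendsto_pow_atTop (by norm_num : 4 ≠ 0)).comp ht)
      refine this.congr fun n => ?_
      simp only [Function.comp_def]
      rw [← pow_mul, ← ht12 n]
    have e3 : Tendsto (fun n : ℕ => (n : ℝ) * Real.exp (-(η / 4 * n))) atTop (𝓝 0) := by
      have := (tendsto_rpow_mul_exp_neg_mul_atTop_nhds_zero 1 (η / 4) (by positivity)).comp
        tendsto_natCast_atTop_atTop (α := ℕ)
      refine this.congr fun n => ?_
      simp
    have := (((e1.const_mul 2).add ((e2.add e2).add e3)).add (hexp (α / 10) (by positivity))).add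
      ((hexp 1 one_pos).const_mul 2)
    simp only [mul_zero, add_zero] at this
    refine this.congr fun n => ?_
    simp only [herr]
    ring
  have hmain : ∀ᶠ n : ℕ in atTop, 1 - err n ≤ probConnected n a (K n) (P n) := by
    filter_upwards [hadm, hb, hdP.bound, eventually_abs_le hβ (by norm_num : (0 : ℝ) < 1 / 20),
      hlim.eventually_ge_atTop 1, hlogn.eventually_ge_atTop 24,
      hKlog.eventually_ge_atTop 128, hKreal.eventually_ge_atTop (Real.log d + 2),
      hKreal.eventually_ge_atTop 48, herr1.eventually_le_const (by norm_num : (0 : ℝ) < 1 / 2),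
      herr2.eventually_le_const (by norm_num : (0 : ℝ) < 1 / 2),
      ht.eventually_ge_atTop 1, eventually_gt_atTop 0,
      hKreal.eventually_ge_atTop (3 / (2 * c)),
      hKreal.eventually_ge_atTop (12 / α / Real.exp (-6)),
      hlogn.eventually_ge_atTop (12 / α * (20 / 19) / (c / 2))]
      with n h hbn hnP hβn hβ1 hℓ24 hK128 hKd hK48 he1 he2 ht1 hn hKc hKα hℓα
    rw [Real.norm_of_nonneg (Nat.cast_nonneg _), Real.norm_of_nonneg (Nat.cast_nonneg _)] at hnP
    have hlogt : Real.log n = 12 * Real.log (t n) := by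
      rw [ht12 n, Real.log_pow]; norm_num
    have := one_sub_probConnected_le_error h hn hα hbn hd hnP hη0 hη1 hηC hc0 hc16 hcη hβn hβ1
      hℓ24 hK128 hKd hK48 ht1 (ht12 n) hlogt
      (le_of_eq_of_le (by rw [hlogt]; ring) he1) (le_of_eq_of_le (by rw [hlogt]; ring) he2)
      hKc hKα hℓα
    simp only [herr]
    linarith
  have hle : ∀ᶠ n : ℕ in atTop, probConnected n a (K n) (P n) ≤ 1 := by
    filter_upwards [hadm] with n h
    have := isProbabilityMeasure_vertexLaw h.pos h.sum h.le_pool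
    have : IsProbabilityMeasure (choicesLaw n a (K n) (P n)) := by
      unfold choicesLaw; infer_instance
    exact measureReal_le_one
  refine tendsto_of_tendsto_of_tendsto_of_le_of_le' ?_ tendsto_const_nhds hmain hle
  simpa using herr0.const_sub 1

theorem theorem1 (m : ℕ) (a : Fin (m + 1) → ℝ) (ha_pos : ∀ i, 0 < a i) (ha_sum : ∑ i, a i = 1)
    (K : ℕ → Fin (m + 1) → ℕ) (P : ℕ → ℕ)
    (hP : (fun n : ℕ => (n : ℝ)) =O[atTop] fun n => (P n : ℝ))
    (hK_first : Tendsto (fun n => K n 0) atTop atTop)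
    (hK_mono : ∀ᶠ n in atTop, Monotone (K n))
    (hK_last : (fun n => (K n (Fin.last m) : ℝ)) =o[atTop] fun n => Real.sqrt (P n))
    (β : ℕ → ℝ) (hβ : β =o[atTop] fun n : ℕ => Real.log n)
    (hb : ∀ᶠ n : ℕ in atTop, ∀ x y : Fin n, x ≠ y →
      edgeProb a (K n) (P n) x y 0 = (Real.log n + β n) / n) :
    (Tendsto β atTop atBot →
      Tendsto (fun n => probConnected n a (K n) (P n)) atTop (𝓝 0)) ∧
    (Tendsto β atTop atTop →
      Tendsto (fun n => probConnected n a (K n) (P n)) atTop (𝓝 1)) := by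
  have hadm := eventually_admissible ha_pos ha_sum hK_first hK_mono hK_last
  have hb' := eventually_edgeProb_eq hadm hb
  exact ⟨tendsto_probConnected_zero hadm hβ hb',
    tendsto_probConnected_one ha_pos hadm hP hK_first hβ hb'⟩
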